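/- Let $K$ be a number field with ring of integers $\mathcal O_K$ and a fixed algebraic closure $\overline K$, and let $X=\{F=0\}\subset\mathbb P^3$ be a smooth quartic surface over $K$. Let $\mathcal L$ be the set of lines of $\mathbb P^3_{\overline K}$ contained in $X$. A *scheme of lines* on $X$ is a pair $(\mathcal S,\eta)$ of a finite ($0$-dimensional) reduced $K$-scheme $\mathcal S$ and a $\mathrm{Gal}(\overline K/K)$-equivariant bijection $\eta:\mathcal S(\overline K)\to\mathcal L$. For a set $L$ of lines in $\mathbb P^3$ over an algebraically closed field, let $\mathcal G(L)$ be the bipartite graph whose vertices are the lines in $L$ and the intersection points of pairs of distinct lines in $L$, and whose edges are the incident pairs (point, line). Put $\mathcal G(\mathcal S,\eta)=\mathcal G(\mathrm{im}\,\eta)$. Let $\mathfrak p$ be a maximal ideal of $\mathcal O_K$ and $\mathbb F_{\mathfrak p}=\mathcal O_K/\mathfrak p$. Given a place of $\overline K$ above $\mathfrak p$ (a valuation ring of $\overline K$ whose maximal ideal meets $\mathcal O_K$ in $\mathfrak p$), with residue field $\overline{\mathbb F_{\mathfrak p}}$, let $r_{\mathfrak p}$ denote the reduction of points and lines of $\mathbb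 P^3$, and of $\overline K$-points of a finite $K$-scheme with a given finite integral model over $\mathcal O_K$; let $\mathcal L_{\mathfrak p}=r_{\mathfrak p}(\mathcal L)$. We say that $(\mathcal S,\eta)$ *has good reduction at $\mathfrak p$* if $\mathcal S$ has a finite flat integral model over $\mathcal O_K$ that is smooth over the localization $(\mathcal O_K)_{\mathfrak p}$, with fibre $\mathcal S_{\mathfrak p}$ over $\mathbb F_{\mathfrak p}$, such that for every place of $\overline K$ above $\mathfrak p$: * $X$ has good reduction: some nonzero multiple of $F$ has coefficients in $\mathcal O_K$, and its reduction modulo $\mathfrak p$ defines a smooth quartic surface; * there is an injective map $\eta_{\mathfrak p}:\mathcal S_{\mathfrak p}(\overline{\mathbb F_{\mathfrak p}})\to\mathcal L_{\mathfrak p}$, equivariant under $\mathrm{Gal}(\overline{\mathbb F_{\mathfrak p}}/\mathbb F_{\mathfrak p})$, with $r_{\mathfrak p}\circ\eta=\eta_{\mathfrak p}\circ r_{\mathfrak p}$ on $\mathcal S(\overline K)$; * the map $r_{\mathfrak p}$ on points and lines induces an isomorphism of bipartite graphs $\mathcal G(\mathcal S,\eta)\cong\mathcal G(\mathcal S_{\mathfrak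 p},\eta_{\mathfrak p})$, where $\mathcal G(\mathcal S_{\mathfrak p},\eta_{\mathfrak p})=\mathcal G(\mathrm{im}\,\eta_{\mathfrak p})$. **Proposition.** A scheme of lines on $X$ exists. For every scheme of lines $(\mathcal S,\eta)$ on $X$ there is a positive integer $D$ such that for every prime number $p\nmid D$ and every maximal ideal $\mathfrak p$ of $\mathcal O_K$ containing $p$, the scheme of lines $(\mathcal S,\eta)$ has good reduction at $\mathfrak p$. In particular, the incidence graph of the lines on $X$ and their intersection points is preserved by reduction modulo $\mathfrak p$. -/

import Mathlib

open scoped NumberField TensorProduct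

namespace LinesOnQuartic

universe u v w

/-! ### Smooth quartics in projective 3-space and their lines

Points and lines of `ℙ³` over a field `Ω` are the linear subspaces of `Ω⁴` of dimension `1`
and `2` respectively. -/

/-- `F` is homogeneous of degree `4` over `k` and `{F = 0} ⊆ ℙ³` is smooth over `k`: by the Jacobian
criterion, over the algebraically closed extension `Ω` of `k`, the form `F` and its
partial derivatives have no common zero in `ℙ³(Ω)`. -/
def IsSmoothQuartic {k : Type u} [CommRing k] (F : MvPolynomial (Fin 4) k)
    (Ω : Type v) [Field Ω] [Algebra k Ω] : Prop :=
  F.IsHomogeneous 4 ∧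
    ∀ x : Fin 4 → Ω, x ≠ 0 → MvPolynomial.aeval x F = 0 →
      ∃ i, MvPolynomial.aeval x (MvPolynomial.pderiv i F) ≠ 0

/-- The set `𝓛` of lines of `ℙ³(Ω)` that lie on the surface `F = 0`. -/
def linesOn {k : Type u} [CommRing k] (F : MvPolynomial (Fin 4) k)
    (Ω : Type v) [Field Ω] [Algebra k Ω] : Set (Submodule Ω (Fin 4 → Ω)) :=
  {W | Module.finrank Ω W = 2 ∧ ∀ x ∈ W, MvPolynomial.aeval x F = 0}

/-- The points of `ℙ³(Ω)` at which two distinct members of a set `L` of lines meet. -/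
def intersectionPoints {Ω : Type v} [Field Ω] (L : Set (Submodule Ω (Fin 4 → Ω))) :
    Set (Submodule Ω (Fin 4 → Ω)) :=
  {q | Module.finrank Ω q = 1 ∧ ∃ l₁ ∈ L, ∃ l₂ ∈ L, l₁ ≠ l₂ ∧ q = l₁ ⊓ l₂}

/-- The bipartite incidence graph of a set `L` of lines: the vertices are the intersection points
of pairs of lines of `L` and the lines of `L`; the edges join `q` to `l` when `q ∈ l`. -/
def incidenceGraph {Ω : Type v} [Field Ω] (L : Set (Submodule Ω (Fin 4 → Ω))) :
    SimpleGraph (intersectionPoints L ⊕ L) where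
  Adj a b := match a, b with
    | .inl q, .inr l => q.1 ≤ l.1
    | .inr l, .inl q => q.1 ≤ l.1
    | _, _ => False
  symm := ⟨by rintro (a | a) (b | b) h <;> exact h⟩
  loopless := ⟨by rintro (a | a) h <;> exact h⟩

/-- A map `η` from the `Ω`-points of `Spec B` to linear subspaces of `Ω⁴` commutes with the
automorphisms `σ` of `Ω` over `k`: `η (σ ∘ p) = σ (η p)`. -/
def IsEquivariant {k : Type u} [CommRing k] {Ω : Type v} [Field Ω] [Algebra k Ω]
    {B : Type w} [CommRing B] [Algebra k B]
    (η : (B →ₐ[k] Ω) → Submodule Ω (Fin 4 → Ω)) : Prop :=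
  ∀ (σ : Ω ≃ₐ[k] Ω) (p : B →ₐ[k] Ω) (x : Fin 4 → Ω),
    (fun i => σ (x i)) ∈ η ((σ : Ω →ₐ[k] Ω).comp p) ↔ x ∈ η p

/-- The pair `(𝒮, η)`: a finite (zero-dimensional) reduced `K`-scheme `𝒮 = Spec B`, whose set of
geometric points is `𝒮(K̄) = (B →ₐ[K] K̄)`, together with a map `η : 𝒮(K̄) → 𝓛` by which `𝒮`
parametrizes the lines on the surface `F = 0`. -/
structure SchemeOfLines {K : Type u} [Field K] (F : MvPolynomial (Fin 4) K)
    (Kbar : Type v) [Field Kbar] [Algebra K Kbar] where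
  /-- the coordinate ring of `𝒮` -/
  B : Type u
  [commRing : CommRing B]
  [algebra : Algebra K B]
  [finite : Module.Finite K B]
  [isReduced : IsReduced B]
  /-- the map from geometric points to lines -/
  η : (B →ₐ[K] Kbar) → Submodule Kbar (Fin 4 → Kbar)
  bijOn : Set.BijOn η Set.univ (linesOn F Kbar)
  equivariant : IsEquivariant η

attribute [instance] SchemeOfLines.commRing SchemeOfLines.algebra SchemeOfLines.finite
  SchemeOfLines.isReduced

/-! ### Places of the algebraic closure and reduction -/

/-- A place of `K̄` above the prime `𝔭` of `𝓞 K`: a valuation ring of `K̄` whose maximal ideal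
(the set of its nonunits) meets `𝓞 K` in `𝔭`. Its residue field is an algebraic closure of
`𝓞 K ⧸ 𝔭`. -/
structure PlaceOver {K : Type u} [Field K] (Kbar : Type v) [Field Kbar] [Algebra K Kbar]
    (𝔭 : Ideal (𝓞 K)) where
  ring : ValuationSubring Kbar
  mem_iff : ∀ x : 𝓞 K, algebraMap (𝓞 K) Kbar x ∈ ring.nonunits ↔ x ∈ 𝔭

theorem mem_of_isIntegral {E : Type v} [Field E] (A : ValuationSubring E) {x : E}
    (hx : IsIntegral ℤ x) : x ∈ A := by
  have h : IsIntegral A x := hx.tower_top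
  obtain ⟨y, hy⟩ := IsIntegrallyClosed.isIntegral_iff.mp h
  exact hy ▸ y.2

/-- There is a place above every prime. -/
theorem PlaceOver.nonempty {K : Type u} [Field K] {Kbar : Type v} [Field Kbar] [Algebra K Kbar]
    (𝔭 : Ideal (𝓞 K)) [𝔭.IsPrime] : Nonempty (PlaceOver Kbar 𝔭) := by
  have hinj : Function.Injective (algebraMap (𝓞 K) Kbar) := by
    rw [IsScalarTower.algebraMap_eq (𝓞 K) K Kbar]
    exact (algebraMap K Kbar).injective.comp NumberField.RingOfIntegers.coe_injective
  have hu : ∀ y : 𝔭.primeCompl, IsUnit (algebraMap (𝓞 K) Kbar y) := fun y =>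
    isUnit_iff_ne_zero.mpr fun h => y.2 (by
      rw [(injective_iff_map_eq_zero _).mp hinj _ h]; exact 𝔭.zero_mem)
  let f : Localization.AtPrime 𝔭 →+* Kbar := IsLocalization.lift hu
  have hf : ∀ x, f (algebraMap _ _ x) = algebraMap (𝓞 K) Kbar x := fun x => IsLocalization.lift_eq hu x
  obtain ⟨V, hle, hloc⟩ := (LocalSubring.range f).exists_le_valuationSubring
  have hmem : ∀ x, f x ∈ V := fun x => hle ⟨x, rfl⟩
  refine ⟨⟨V, fun x => ?_⟩⟩
  rw [ValuationSubring.mem_nonunits_iff_or]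
  constructor
  · intro h
    by_contra hx
    rcases h with h | h
    · exact hx ((injective_iff_map_eq_zero _).mp hinj _ h ▸ 𝔭.zero_mem)
    · apply h
      obtain ⟨y, hy⟩ := IsLocalization.map_units (Localization.AtPrime 𝔭) (⟨x, hx⟩ : 𝔭.primeCompl)
      have h1 : f ↑y⁻¹ = (algebraMap (𝓞 K) Kbar x)⁻¹ := by
        rw [← hf x]; apply eq_inv_of_mul_eq_one_left; rw [← map_mul, ← hy]; simp
      exact h1 ▸ hmem _
  · intro hx
    by_cases h0 : algebraMap (𝓞 K) Kbar x = 0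
    · exact .inl h0
    refine .inr fun hV => ?_
    have hun := hloc.1 ⟨algebraMap (𝓞 K) Kbar x, algebraMap _ _ x, hf x⟩
      (isUnit_iff_exists_inv.mpr ⟨⟨_, hV⟩, Subtype.ext (mul_inv_cancel₀ h0)⟩)
    obtain ⟨⟨_, z, rfl⟩, hz⟩ := isUnit_iff_exists_inv.mp hun
    have hz' : algebraMap (𝓞 K) Kbar x * f z = 1 := congrArg Subtype.val hz
    obtain ⟨a, s, rfl⟩ := IsLocalization.exists_mk'_eq 𝔭.primeCompl z
    have : algebraMap (𝓞 K) Kbar (x * a) = algebraMap (𝓞 K) Kbar s := by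
      have h2 := IsLocalization.mk'_spec (Localization.AtPrime 𝔭) a s
      have h3 := congrArg f h2
      rw [map_mul, hf, hf] at h3
      rw [map_mul, ← h3, ← mul_assoc, hz', one_mul]
    exact s.2 (hinj this ▸ 𝔭.mul_mem_right a hx)

section Place

variable {K : Type u} [Field K] {Kbar : Type v} [Field Kbar] [Algebra K Kbar] {𝔭 : Ideal (𝓞 K)}

theorem mem_of_isIntegral_ringOfIntegers (A : ValuationSubring Kbar) {x : Kbar}
    (hx : IsIntegral (𝓞 K) x) : x ∈ A :=
  mem_of_isIntegral A (isIntegral_trans (R := ℤ) (A := 𝓞 K) x hx)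

/-- The residue field `k` of the place. -/
abbrev PlaceOver.Residue (P : PlaceOver Kbar 𝔭) : Type v := IsLocalRing.ResidueField P.ring

instance PlaceOver.algebraRing (P : PlaceOver Kbar 𝔭) : Algebra (𝓞 K) P.ring :=
  ((algebraMap (𝓞 K) Kbar).codRestrict P.ring
    (fun _ => mem_of_isIntegral_ringOfIntegers P.ring isIntegral_algebraMap)).toAlgebra

theorem PlaceOver.algebraMap_eq_zero (P : PlaceOver Kbar 𝔭) (x : 𝓞 K) (hx : x ∈ 𝔭) :
    algebraMap (𝓞 K) P.Residue x = 0 := by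
  have h := (P.mem_iff x).mpr hx
  rw [IsScalarTower.algebraMap_apply (𝓞 K) P.ring P.Residue, IsLocalRing.ResidueField.algebraMap_eq,
    IsLocalRing.residue_eq_zero_iff]
  exact (ValuationSubring.mem_nonunits_iff_exists_mem_maximalIdeal.mp h).2

/-- The inclusion of the residue field `𝓞 K ⧸ 𝔭` of `𝔭` in the residue field of the place. -/
noncomputable instance PlaceOver.algebraResidue (P : PlaceOver Kbar 𝔭) : Algebra (𝓞 K ⧸ 𝔭) P.Residue :=
  (Ideal.Quotient.lift 𝔭 (algebraMap (𝓞 K) P.Residue) P.algebraMap_eq_zero).toAlgebra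

instance PlaceOver.isScalarTower (P : PlaceOver Kbar 𝔭) :
    IsScalarTower (𝓞 K) (𝓞 K ⧸ 𝔭) P.Residue :=
  IsScalarTower.of_algebraMap_eq fun _ => rfl

/-- The reduction map `r_𝔭` on linear subspaces `W` of `K̄⁴` (points and lines of `ℙ³`): the
residues of the vectors of `W` whose coordinates belong to the valuation ring. -/
noncomputable def PlaceOver.reduce (P : PlaceOver Kbar 𝔭) (W : Submodule Kbar (Fin 4 → Kbar)) :
    Submodule P.Residue (Fin 4 → P.Residue) where
  carrier := {y | ∃ x : Fin 4 → P.ring,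
    (fun i => (x i : Kbar)) ∈ W ∧ y = fun i => IsLocalRing.residue P.ring (x i)}
  add_mem' := by
    rintro _ _ ⟨x, hx, rfl⟩ ⟨x', hx', rfl⟩
    exact ⟨x + x', W.add_mem hx hx', by ext i; simp⟩
  zero_mem' := ⟨0, W.zero_mem, by ext i; simp⟩
  smul_mem' := by
    rintro c _ ⟨x, hx, rfl⟩
    obtain ⟨a, rfl⟩ := IsLocalRing.residue_surjective c
    exact ⟨a • x, W.smul_mem (a : Kbar) hx, by ext i; simp⟩

end Place

/-! ### Integral models of a finite scheme -/

/-- An integral model over `𝓞 K` of the finite `K`-scheme `Spec B`: the spectrum of an order of `B`,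
that is, of a finite `𝓞 K`-subalgebra of `B` which generates `B` over `K`. -/
structure IntegralModel (K : Type u) [Field K] (B : Type w) [CommRing B] [Algebra K B] where
  order : Subalgebra (𝓞 K) B
  finite : Module.Finite (𝓞 K) order
  span_eq_top : Submodule.span K (order : Set B) = ⊤

section Model

variable {K : Type u} [Field K] {B : Type w} [CommRing B] [Algebra K B]

/-- The morphism induced by the model over the localization of `𝓞 K` at `𝔭` is smooth. -/
def IntegralModel.IsSmoothAt (M : IntegralModel K B) (𝔭 : Ideal (𝓞 K)) [𝔭.IsPrime] : Prop :=
  Algebra.Smooth (Localization.AtPrime 𝔭) (Localization.AtPrime 𝔭 ⊗[𝓞 K] M.order)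

/-- The coordinate ring of the fibre `𝒮_𝔭` of the model over `𝓞 K ⧸ 𝔭`. -/
abbrev IntegralModel.Fibre (M : IntegralModel K B) (𝔭 : Ideal (𝓞 K)) : Type (max u w) :=
  (𝓞 K ⧸ 𝔭) ⊗[𝓞 K] M.order

variable {Kbar : Type v} [Field Kbar] [Algebra K Kbar] {𝔭 : Ideal (𝓞 K)}

theorem IntegralModel.isIntegral_apply (M : IntegralModel K B) (p : B →ₐ[K] Kbar) (b : M.order) :
    IsIntegral (𝓞 K) (p b) := by
  have := M.finite
  have h : IsIntegral (𝓞 K) b := Algebra.IsIntegral.isIntegral b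
  exact h.map ((p.restrictScalars (𝓞 K)).comp M.order.val)

/-- The restriction of a geometric point `p : B → K̄` to the order, with values in the valuation
ring. -/
noncomputable def IntegralModel.restrict (M : IntegralModel K B) (P : PlaceOver Kbar 𝔭)
    (p : B →ₐ[K] Kbar) : M.order →ₐ[𝓞 K] P.ring where
  toFun b := ⟨p b, mem_of_isIntegral_ringOfIntegers P.ring (M.isIntegral_apply p b)⟩
  map_one' := Subtype.ext (by simp)
  map_mul' _ _ := Subtype.ext (by simp)
  map_zero' := Subtype.ext (by simp)
  map_add' _ _ := Subtype.ext (by simp)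
  commutes' r := Subtype.ext ((p.restrictScalars (𝓞 K)).commutes r)

/-- The reduction map `r_𝔭 : 𝒮(K̄) → 𝒮_𝔭(k)` on geometric points: the point `p` is sent to the
point `a ⊗ b ↦ a · (residue of p b)`. -/
noncomputable def IntegralModel.reducePoint (M : IntegralModel K B) (P : PlaceOver Kbar 𝔭)
    (p : B →ₐ[K] Kbar) : M.Fibre 𝔭 →ₐ[𝓞 K ⧸ 𝔭] P.Residue :=
  Algebra.TensorProduct.lift (Algebra.ofId (𝓞 K ⧸ 𝔭) P.Residue)
    ((IsScalarTower.toAlgHom (𝓞 K) P.ring P.Residue).comp (M.restrict P p))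
    (fun _ _ => Commute.all _ _)

end Model

/-! ### Good reduction -/

section GoodReduction

variable {K : Type u} [Field K] {Kbar : Type v} [Field Kbar] [Algebra K Kbar]

/-- The surface `F = 0` has good reduction at the place: up to a nonzero constant, `F` is the
generic fibre of a quartic form over `𝓞 K` whose reduction modulo `𝔭` is a smooth quartic. -/
def QuarticGoodReduction (F : MvPolynomial (Fin 4) K) {𝔭 : Ideal (𝓞 K)} (P : PlaceOver Kbar 𝔭) :
    Prop :=
  ∃ (G : MvPolynomial (Fin 4) (𝓞 K)) (c : K), c ≠ 0 ∧
    MvPolynomial.map (algebraMap (𝓞 K) K) G = MvPolynomial.C c * F ∧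
    IsSmoothQuartic (MvPolynomial.map (Ideal.Quotient.mk 𝔭) G) P.Residue

/-- The scheme of lines `(𝒮, η)` on `F = 0` has good reduction at `𝔭`: there is an integral model of
`𝒮` which is smooth at `𝔭` and, for every place above `𝔭` (that is, for every choice of the
reduction map `r_𝔭`), the surface has good reduction and there is an injective map
`η_𝔭 : 𝒮_𝔭(k) → 𝓛_𝔭 = r_𝔭(𝓛)`, compatible with the automorphisms of `k` over `𝓞 K ⧸ 𝔭`,
such that `r_𝔭 ∘ η = η_𝔭 ∘ r_𝔭`, and `r_𝔭` induces an isomorphism of bipartite graphs from the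
incidence graph of `(𝒮, η)` to that of `(𝒮_𝔭, η_𝔭)`. -/
def SchemeOfLines.HasGoodReductionAt {F : MvPolynomial (Fin 4) K} (S : SchemeOfLines F Kbar)
    (𝔭 : Ideal (𝓞 K)) [𝔭.IsMaximal] : Prop :=
  ∃ M : IntegralModel K S.B, M.IsSmoothAt 𝔭 ∧
    ∀ P : PlaceOver Kbar 𝔭,
      QuarticGoodReduction F P ∧
      ∃ η' : (M.Fibre 𝔭 →ₐ[𝓞 K ⧸ 𝔭] P.Residue) → Submodule P.Residue (Fin 4 → P.Residue),
        (∀ q, η' q ∈ P.reduce '' linesOn F Kbar) ∧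
        Function.Injective η' ∧
        IsEquivariant η' ∧
        (∀ p : S.B →ₐ[K] Kbar, P.reduce (S.η p) = η' (M.reducePoint P p)) ∧
        ∃ φ : incidenceGraph (Set.range S.η) ≃g incidenceGraph (Set.range η'),
          (∀ q : intersectionPoints (Set.range S.η),
            ∃ q' : intersectionPoints (Set.range η'),
              φ (Sum.inl q) = Sum.inl q' ∧ q'.1 = P.reduce q.1) ∧
          (∀ l : Set.range S.η,
            ∃ l' : Set.range η', φ (Sum.inr l) = Sum.inr l' ∧ l'.1 = P.reduce l.1)

end GoodReduction

end LinesOnQuartic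

namespace LinesOnQuartic

universe u v w

/-! ### Finiteness of zero sets with trivial tangent spaces -/

/-! A smooth quartic contains finitely many lines because a line on it has no first-order
deformation (`tangent_eq_zero`). In coordinates a deformation is a relation `a * P + b * Q = 0`,
where `a`, `b` are linear forms on the line and `P`, `Q` are the restrictions of two partial
derivatives of `F`. These cubics have no common zero, by smoothness, so `a` and `b` vanish. A system
of equations without tangent vectors has finitely many solutions
(`finite_zeros_of_tangent_eq_zero`).

Each line has a normalized basis that commutes with Galois (`frame_galConj`). A natural-number
combination of its coordinates separates the lines, and the monic polynomial `g` with these values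
as roots descends to `K`; then `K[X]/(g)` is a scheme of lines.

For good reduction, choose an integral element `θ` of `B` separating the geometric points. The model
is `𝓞 K[θ]`, isomorphic to `𝓞 K[X]/(f)` with `f = ∏ (X - p θ)`, and a Bézout identity `a * f + b *
f' = N` makes it étale away from `N`. Lagrange interpolation writes spanning vectors of the lines as
polynomials over `𝓞 K` in `p θ`. When geometric points reduce bijectively, the same polynomials
evaluated at the points of the fibre describe `η'`. Its equivariance is then visible, with no
lifting of residue field automorphisms to `Kbar`.

Everything else is a finite list of linear algebra facts: ranks of subspaces and their intersections
are preserved by reduction. Each needs finitely many algebraic numbers to lie in the valuation ring,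
hence holds once some positive integer is invertible there. The filter `almostAll` collects these
conditions into a single `D`. Smoothness of the reduced quartic comes from the Nullstellensatz with
denominators cleared (`exists_quarticGoodReduction`). -/

theorem derivation_mvPolynomial_eq_sum {k σ M : Type*} [CommRing k] [Fintype σ] [AddCommGroup M]
    [Module k M] [Module (MvPolynomial σ k) M] [IsScalarTower k (MvPolynomial σ k) M]
    (D : Derivation k (MvPolynomial σ k) M) (f : MvPolynomial σ k) :
    D f = ∑ i, MvPolynomial.pderiv i f • D (MvPolynomial.X i) := by
  classical
  have hsum : ∀ g : σ → Derivation k (MvPolynomial σ k) M, ⇑(∑ i, g i) = ∑ i, ⇑(g i) := fun g =>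
    map_sum (Derivation.coeFnAddMonoidHom (R := k) (A := MvPolynomial σ k) (M := M)) g _
  have h : D = ∑ i, (LinearMap.toSpanSingleton (MvPolynomial σ k) M (D (MvPolynomial.X i))).compDer
      (MvPolynomial.pderiv i) := by
    refine MvPolynomial.derivation_ext fun j => ?_
    rw [hsum, Finset.sum_apply, Finset.sum_eq_single j]
    · simp
    · intro i _ hij
      simp [MvPolynomial.pderiv_X_of_ne hij.symm]
    · simp
  have h2 := congrArg (fun d => d f) h
  simp only [hsum, Finset.sum_apply] at h2
  exact h2

/-- If the Kähler differentials of the coordinate ring `A` were nonzero, a simple quotient `A ⧸ m`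
of them would give a nonzero derivation into the residue field of a point, that is, a nonzero
tangent vector. So `A` is unramified over `k`, hence finite over `k`, and has finitely many points.
-/
theorem finite_zeros_of_tangent_eq_zero {k σ : Type*} [Field k] [IsAlgClosed k] [Fintype σ]
    (S : Set (MvPolynomial σ k))
    (H : ∀ x v : σ → k, (∀ f ∈ S, MvPolynomial.eval x f = 0) →
      (∀ f ∈ S, ∑ i, MvPolynomial.eval x (MvPolynomial.pderiv i f) * v i = 0) → v = 0) :
    {x : σ → k | ∀ f ∈ S, MvPolynomial.eval x f = 0}.Finite := by
  classical
  let I := Ideal.span S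
  let A := MvPolynomial σ k ⧸ I
  have hsub : Subsingleton (Ω[A⁄k]) := by
    by_contra hn
    rw [not_subsingleton_iff_nontrivial] at hn
    have hfin : Module.Finite A (Ω[A⁄k]) := inferInstance
    obtain ⟨N, hN, -⟩ := (eq_top_or_exists_le_coatom (⊥ : Submodule A (Ω[A⁄k]))).resolve_left
      bot_ne_top
    have hs : IsSimpleModule A (Ω[A⁄k] ⧸ N) := isSimpleModule_iff_isCoatom.mpr hN
    obtain ⟨m, hm, ⟨e⟩⟩ := isSimpleModule_iff_quot_maximal.mp hs
    let φ : Ω[A⁄k] →ₗ[A] A ⧸ m := e.toLinearMap ∘ₗ N.mkQ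
    have hφ : Function.Surjective φ := e.surjective.comp N.mkQ_surjective
    let D : Derivation k A (A ⧸ m) := φ.compDer (KaehlerDifferential.D k A)
    let : Field (A ⧸ m) := Ideal.Quotient.field m
    -- By the Nullstellensatz the residue field is `k`, so `m` is a point `x` and the derivation is
    -- a vector `v` with coordinates in `k`.
    have hfinm : Module.Finite k (A ⧸ m) := finite_of_finite_type_of_isJacobsonRing k (A ⧸ m)
    have hbij : Function.Bijective (algebraMap k (A ⧸ m)) :=
      IsAlgClosed.algebraMap_bijective_of_isIntegral
    choose x hx using fun i => hbij.2 (algebraMap A (A ⧸ m) (Ideal.Quotient.mk I (MvPolynomial.X i)))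
    choose v hv using fun i => hbij.2 (D (Ideal.Quotient.mk I (MvPolynomial.X i)))
    have hev : ∀ f : MvPolynomial σ k, algebraMap A (A ⧸ m) (Ideal.Quotient.mk I f) =
        algebraMap k (A ⧸ m) (MvPolynomial.eval x f) := by
      intro f
      have : ((IsScalarTower.toAlgHom k A (A ⧸ m)).comp (Ideal.Quotient.mkₐ k I)) =
          (Algebra.ofId k (A ⧸ m)).comp (MvPolynomial.aeval x) := by
        refine MvPolynomial.algHom_ext fun i => ?_
        simpa [Algebra.ofId_apply] using! (hx i).symm
      exact congrArg (fun g => g f) this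
    have hD : ∀ f : MvPolynomial σ k, D (Ideal.Quotient.mk I f) = algebraMap k (A ⧸ m)
        (∑ i, MvPolynomial.eval x (MvPolynomial.pderiv i f) * v i) := by
      intro f
      have h1 := derivation_mvPolynomial_eq_sum (D.compAlgebraMap (MvPolynomial σ k)) f
      refine h1.trans ?_
      rw [map_sum]
      refine Finset.sum_congr rfl fun i _ => ?_
      rw [map_mul, hv, ← hev]
      rfl
    have hv0 : v = 0 := H x v
      (fun f hf => hbij.1 (by
        rw [← hev, Ideal.Quotient.eq_zero_iff_mem.mpr (Ideal.subset_span hf), map_zero, map_zero]))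
      (fun f hf => hbij.1 (by
        rw [← hD, Ideal.Quotient.eq_zero_iff_mem.mpr (Ideal.subset_span hf), map_zero, map_zero]))
    have hD0 : ∀ a, D a = 0 := by
      intro a
      obtain ⟨f, rfl⟩ := Ideal.Quotient.mk_surjective a
      rw [hD, hv0]; simp
    have hφ0 : φ = 0 := by
      refine LinearMap.ext_on_range (v := KaehlerDifferential.D k A)
        (KaehlerDifferential.span_range_derivation k A) fun a => ?_
      exact hD0 a
    obtain ⟨y, hy⟩ := hφ 1
    rw [hφ0] at hy
    exact zero_ne_one hy
  have hunr : Algebra.FormallyUnramified k A := ⟨hsub⟩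
  have hfin : Module.Finite k A := Algebra.FormallyUnramified.finite_of_free k A
  have hA : Finite (A →ₐ[k] k) := inferInstance
  have hlift : ∀ x : {x : σ → k | ∀ f ∈ S, MvPolynomial.eval x f = 0},
      ∀ a ∈ I, MvPolynomial.aeval x.1 a = 0 := by
    rintro ⟨x, hx⟩ a ha
    have : I ≤ RingHom.ker (MvPolynomial.aeval x : MvPolynomial σ k →ₐ[k] k) :=
      Ideal.span_le.mpr fun f hf => by
        simpa [RingHom.mem_ker, MvPolynomial.aeval_eq_eval] using hx f hf
    exact this ha
  let ψ : {x : σ → k | ∀ f ∈ S, MvPolynomial.eval x f = 0} → (A →ₐ[k] k) := fun x =>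
    Ideal.Quotient.liftₐ I (MvPolynomial.aeval x.1) (hlift x)
  have hψ : Function.Injective ψ := by
    intro x y hxy
    refine Subtype.ext (funext fun i => ?_)
    have hev : ∀ z, ψ z (Ideal.Quotient.mk I (MvPolynomial.X i)) = z.1 i := fun z =>
      MvPolynomial.aeval_X z.1 i
    rw [← hev, hxy, hev]
  exact Finite.of_injective ψ hψ

/-- First-order Taylor expansion, exact because `ε ^ 2 = 0`. -/
theorem aeval_dualNumber {k R σ : Type*} [CommRing k] [CommRing R] [Algebra k R] [Fintype σ]
    (x v : σ → R) (f : MvPolynomial σ k) :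
    MvPolynomial.aeval (fun i => (TrivSqZeroExt.inl (x i) + TrivSqZeroExt.inr (v i) :
      DualNumber R)) f = TrivSqZeroExt.inl (MvPolynomial.aeval x f) +
        TrivSqZeroExt.inr (∑ i, MvPolynomial.aeval x (MvPolynomial.pderiv i f) * v i) := by
  classical
  induction f using MvPolynomial.induction_on with
  | C a =>
    have h : (algebraMap k (DualNumber R)) a = TrivSqZeroExt.inl (algebraMap k R a) := rfl
    simp [h]
  | add p q hp hq =>
    rw [map_add, hp, hq]
    simp [TrivSqZeroExt.ext_iff, Finset.sum_add_distrib, add_mul]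
  | mul_X p j hp =>
    rw [map_mul, hp]
    simp [TrivSqZeroExt.ext_iff, Finset.sum_add_distrib, add_mul, MvPolynomial.pderiv_X, Pi.single_apply]
    have h : ∀ a, MvPolynomial.aeval x (if j = a then p else 0) * v a =
        if j = a then MvPolynomial.aeval x p * v a else 0 := fun a => by split_ifs <;> simp
    rw [Finset.sum_congr rfl fun a _ => h a, Finset.sum_ite_eq, if_pos (Finset.mem_univ j),
      Finset.sum_mul]
    exact congrArg _ (Finset.sum_congr rfl fun a _ => by ring)

/-! ### Lines on a smooth quartic -/

theorem coeff_aeval_monomial_linear {k L : Type*} [CommRing k] [Field L] [Algebra k L]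
    (v w : Fin 4 → L) (d : Fin 4 →₀ ℕ) (c : k) :
    (MvPolynomial.aeval (fun m => (Polynomial.C (v m) * Polynomial.X + Polynomial.C (w m)))
      (MvPolynomial.monomial d c)).coeff d.degree = MvPolynomial.aeval v (MvPolynomial.monomial d c) := by
  have hl : ∀ m n, (((Polynomial.C (v m) * Polynomial.X + Polynomial.C (w m)) ^ n).natDegree ≤ n) := by
    intro m n
    exact Polynomial.natDegree_pow_le_of_le n Polynomial.natDegree_linear_le |>.trans (by simp)
  have hc : ∀ m n, ((Polynomial.C (v m) * Polynomial.X + Polynomial.C (w m)) ^ n).coeff n = v m ^ n := by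
    intro m n
    have := Polynomial.coeff_pow_of_natDegree_le (m := n) (Polynomial.natDegree_linear_le (a := v m) (b := w m))
    simpa using this
  have hm : ∀ (p q : Polynomial L) (a b : ℕ), p.natDegree ≤ a → q.natDegree ≤ b →
      (p * q).natDegree ≤ a + b := fun p q a b => Polynomial.natDegree_mul_le_of_le
  have hd : d.degree = d 0 + d 1 + d 2 + d 3 := by
    rw [Finsupp.degree_eq_sum, Fin.sum_univ_four]
  rw [MvPolynomial.aeval_monomial, MvPolynomial.aeval_monomial,
    Finsupp.prod_fintype _ _ (by simp), Finsupp.prod_fintype _ _ (by simp), Fin.prod_univ_four,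
    Fin.prod_univ_four, hd, IsScalarTower.algebraMap_apply k L (Polynomial L),
    Polynomial.algebraMap_eq, Polynomial.coeff_C_mul,
    Polynomial.coeff_mul_add_eq_of_natDegree_le (hm _ _ _ _ (hm _ _ _ _ (hl _ _) (hl _ _)) (hl _ _)) (hl _ _),
    Polynomial.coeff_mul_add_eq_of_natDegree_le (hm _ _ _ _ (hl _ _) (hl _ _)) (hl _ _),
    Polynomial.coeff_mul_add_eq_of_natDegree_le (hl _ _) (hl _ _), hc, hc, hc, hc]

/-- The top coefficient of a form restricted to the affine line `X v + w` is its value at the point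
at infinity `v`. This recovers the point lost on dehomogenizing. -/
theorem coeff_aeval_linear {k L : Type*} [CommRing k] [Field L] [Algebra k L]
    {G : MvPolynomial (Fin 4) k} {n : ℕ} (hG : G.IsHomogeneous n) (v w : Fin 4 → L) :
    (MvPolynomial.aeval (fun m => (Polynomial.C (v m) * Polynomial.X + Polynomial.C (w m)))
      G).coeff n = MvPolynomial.aeval v G := by
  conv_lhs => rw [MvPolynomial.as_sum G]
  conv_rhs => rw [MvPolynomial.as_sum G]
  rw [map_sum, map_sum, Polynomial.finsetSum_coeff]
  refine Finset.sum_congr rfl fun d hd => ?_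
  rw [← coeff_aeval_monomial_linear v w, hG.degree_eq_sum_deg_support hd]
  rfl

/-- Coprimality forces `A ∣ b`, which is impossible for nonzero `b` of degree at most one when `A`
has degree at least three; symmetrically for `B`. -/
theorem eq_zero_of_mul_add_mul_eq_zero {k : Type*} [Field k] {A B a b : Polynomial k}
    (hAB : IsCoprime A B) (h : a * A + b * B = 0) (ha : a.natDegree ≤ 1) (hb : b.natDegree ≤ 1)
    (h3 : A.coeff 3 ≠ 0 ∨ B.coeff 3 ≠ 0) : a = 0 ∧ b = 0 := by
  have key : ∀ {A B a b : Polynomial k}, IsCoprime A B → a * A + b * B = 0 →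
      b.natDegree ≤ 1 → A.coeff 3 ≠ 0 → a = 0 ∧ b = 0 := by
    intro A B a b hAB h hb h3
    have hA : A ≠ 0 := by rintro rfl; simp at h3
    have hdvd : A ∣ b := hAB.dvd_of_dvd_mul_right ⟨-a, by linear_combination h⟩
    have hb0 : b = 0 := by
      by_contra hb0
      have h1 := Polynomial.natDegree_le_of_dvd hdvd hb0
      have h2 := Polynomial.le_natDegree_of_ne_zero h3
      omega
    rw [hb0, zero_mul, add_zero] at h
    exact ⟨(mul_eq_zero.mp h).resolve_right hA, hb0⟩
  rcases h3 with h3 | h3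
  · exact key hAB h hb h3
  · exact (key hAB.symm (by rwa [add_comm]) ha h3).symm

/-- Over an infinite field, vanishing for all values of `s` is vanishing as a polynomial in `s`, so
`s = ε` may be substituted. -/
theorem sum_aeval_pderiv_mul_eq_zero {k L : Type*} [CommRing k] [Field L] [Infinite L] [Algebra k L]
    (F : MvPolynomial (Fin 4) k) (x v : Fin 4 → L)
    (h : ∀ s : L, MvPolynomial.aeval (fun m => x m + s * v m) F = 0) :
    ∑ m, MvPolynomial.aeval x (MvPolynomial.pderiv m F) * v m = 0 := by
  have hQ : MvPolynomial.aeval (fun m => (Polynomial.C (x m) + Polynomial.X * Polynomial.C (v m))) F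
      = 0 := by
    refine Polynomial.funext fun s => ?_
    have : ((Polynomial.aeval s : Polynomial L →ₐ[L] L).restrictScalars k)
        (MvPolynomial.aeval (fun m => (Polynomial.C (x m) + Polynomial.X * Polynomial.C (v m))) F)
        = 0 := by
      rw [MvPolynomial.comp_aeval_apply, ← h s]
      congr 2
      funext m
      simp only [AlgHom.restrictScalars_apply, Polynomial.coe_aeval_eq_eval, Polynomial.eval_add,
        Polynomial.eval_mul, Polynomial.eval_C, Polynomial.eval_X]
    simpa [Polynomial.coe_aeval_eq_eval] using this
  have h2 := congrArg ((Polynomial.aeval (TrivSqZeroExt.inr 1 : DualNumber L) :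
    Polynomial L →ₐ[L] DualNumber L).restrictScalars k) hQ
  rw [MvPolynomial.comp_aeval_apply, map_zero] at h2
  have h3 := aeval_dualNumber x v F
  have h4 : ∀ a : L, algebraMap L (DualNumber L) a = TrivSqZeroExt.inl a := fun a => rfl
  have h5 : (fun m => ((Polynomial.aeval (TrivSqZeroExt.inr 1 : DualNumber L) :
      Polynomial L →ₐ[L] DualNumber L).restrictScalars k)
        (Polynomial.C (x m) + Polynomial.X * Polynomial.C (v m))) =
      fun i => (TrivSqZeroExt.inl (x i) + TrivSqZeroExt.inr (v i) : DualNumber L) := by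
    funext m
    simp [h4, TrivSqZeroExt.ext_iff]
  rw [h5, h3] at h2
  simpa using congrArg TrivSqZeroExt.snd h2

theorem exists_compl_pair : ∀ i j : Fin 4, i ≠ j → ∃ k l : Fin 4,
    i ∉ ({j, k, l} : Finset (Fin 4)) ∧ j ∉ ({k, l} : Finset (Fin 4)) ∧ k ≠ l ∧
      (Finset.univ : Finset (Fin 4)) = {i, j, k, l} := by
  decide

/-- The normal bundle of a line on a smooth quartic has degree `-2`, so it has no sections.
Normalizing the coordinates `i`, `j` leaves deformations only in the two complementary coordinates,
which trivializes the normal directions and turns this into an explicit statement on linear forms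
and cubics. -/
theorem tangent_eq_zero {k Ω : Type*} [CommRing k] [Field Ω] [IsAlgClosed Ω] [Algebra k Ω]
    {F : MvPolynomial (Fin 4) k} (hF : IsSmoothQuartic F Ω) {i j : Fin 4} {v w v' w' : Fin 4 → Ω}
    (hvi : v i = 1) (hvj : v j = 0) (hwi : w i = 0) (hwj : w j = 1)
    (hvi' : v' i = 0) (hvj' : v' j = 0) (hwi' : w' i = 0) (hwj' : w' j = 0)
    (h : ∀ s t : Ω, MvPolynomial.aeval (fun m => s * v m + t * w m) F = 0)
    (h' : ∀ s t : Ω, ∑ m, MvPolynomial.aeval (fun m => s * v m + t * w m)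
      (MvPolynomial.pderiv m F) * (s * v' m + t * w' m) = 0) : v' = 0 ∧ w' = 0 := by
  have hinf : Infinite Ω := inferInstance
  have hij : i ≠ j := by rintro rfl; exact zero_ne_one (hwi.symm.trans hwj)
  obtain ⟨k', l, hi, hj, hkl, huniv⟩ := exists_compl_pair i j hij
  have hsum : ∀ {M : Type _} [AddCommMonoid M] (f : Fin 4 → M), ∑ m, f m = f i + (f j + (f k' + f l)) := by
    intro M _ f
    rw [huniv, Finset.sum_insert hi, Finset.sum_insert hj, Finset.sum_pair hkl]
  -- The derivatives of `F` along `v` and `w` vanish on the line. If the partials in the directions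
  -- `k'`, `l` vanish at a point too, so do those in the directions `i`, `j`, and the point is
  -- singular.
  have hne : ∀ s t : Ω, (s ≠ 0 ∨ t ≠ 0) →
      MvPolynomial.aeval (fun m => s * v m + t * w m) (MvPolynomial.pderiv k' F) ≠ 0 ∨
      MvPolynomial.aeval (fun m => s * v m + t * w m) (MvPolynomial.pderiv l F) ≠ 0 := by
    intro s t hst
    by_contra! hcon
    obtain ⟨hk0, hl0⟩ := hcon
    have e1 := sum_aeval_pderiv_mul_eq_zero F (fun m => s * v m + t * w m) v fun r => by
      rw [← h (s + r) t]; congr 2; funext m; ring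
    have e2 := sum_aeval_pderiv_mul_eq_zero F (fun m => s * v m + t * w m) w fun r => by
      rw [← h s (t + r)]; congr 2; funext m; ring
    rw [hsum, hvi, hvj, hk0, hl0] at e1
    rw [hsum, hwi, hwj, hk0, hl0] at e2
    simp only [mul_one, mul_zero, zero_mul, add_zero, zero_add] at e1 e2
    obtain ⟨m, hm⟩ := hF.2 (fun m => s * v m + t * w m) (by
      intro h0
      have a1 := congrFun h0 i
      have a2 := congrFun h0 j
      simp [hvi, hwi, hvj, hwj] at a1 a2
      exact hst.elim (fun a => a a1) (fun a => a a2)) (h s t)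
    have : m ∈ ({i, j, k', l} : Finset (Fin 4)) := huniv ▸ Finset.mem_univ m
    simp only [Finset.mem_insert, Finset.mem_singleton] at this
    rcases this with rfl | rfl | rfl | rfl
    exacts [hm e1, hm e2, hm hk0, hm hl0]
  let P : Fin 4 → Polynomial Ω := fun n =>
    MvPolynomial.aeval (fun m => (Polynomial.C (v m) * Polynomial.X + Polynomial.C (w m)))
      (MvPolynomial.pderiv n F)
  have hP : ∀ n s, (P n).eval s = MvPolynomial.aeval (fun m => s * v m + 1 * w m)
      (MvPolynomial.pderiv n F) := by
    intro n s
    have : ((Polynomial.aeval s : Polynomial Ω →ₐ[Ω] Ω).restrictScalars k) (P n) =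
        MvPolynomial.aeval (fun m => s * v m + 1 * w m) (MvPolynomial.pderiv n F) := by
      rw [MvPolynomial.comp_aeval_apply]
      congr 2
      funext m
      simp only [AlgHom.restrictScalars_apply, Polynomial.coe_aeval_eq_eval, Polynomial.eval_add,
        Polynomial.eval_mul, Polynomial.eval_C, Polynomial.eval_X]
      ring
    simpa [Polynomial.coe_aeval_eq_eval] using this
  have hP3 : ∀ n, (P n).coeff 3 = MvPolynomial.aeval v (MvPolynomial.pderiv n F) :=
    fun n => coeff_aeval_linear (hF.1.pderiv) v w
  let a : Fin 4 → Polynomial Ω := fun n => Polynomial.C (v' n) * Polynomial.X + Polynomial.C (w' n)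
  have hcop : IsCoprime (P k') (P l) := by
    rw [Polynomial.isCoprime_iff_aeval_ne_zero_of_isAlgClosed Ω Ω]
    intro s
    simpa [Polynomial.coe_aeval_eq_eval, hP] using hne s 1 (Or.inr one_ne_zero)
  have hrel : a k' * P k' + a l * P l = 0 := by
    refine Polynomial.funext fun s => ?_
    have := h' s 1
    rw [hsum, hvi', hvj', hwi', hwj'] at this
    simp only [Polynomial.eval_add, Polynomial.eval_mul, hP, a, Polynomial.eval_C,
      Polynomial.eval_X, Polynomial.eval_zero]
    linear_combination this
  -- The absence of a common zero at `s = 1`, `t = 0` says that one of the two polynomials really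
  -- has degree three.
  obtain ⟨hak, hal⟩ := eq_zero_of_mul_add_mul_eq_zero hcop hrel Polynomial.natDegree_linear_le
    Polynomial.natDegree_linear_le (by
      rw [hP3, hP3]
      simpa using hne 1 0 (Or.inl one_ne_zero))
  have hc : ∀ n, a n = 0 → v' n = 0 ∧ w' n = 0 := by
    intro n hn
    have h0 := congrArg (Polynomial.coeff · 0) hn
    have h1 := congrArg (Polynomial.coeff · 1) hn
    simp [a] at h0 h1
    exact ⟨h1, h0⟩
  have hall : ∀ m, v' m = 0 ∧ w' m = 0 := by
    intro m
    have : m ∈ ({i, j, k', l} : Finset (Fin 4)) := huniv ▸ Finset.mem_univ m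
    simp only [Finset.mem_insert, Finset.mem_singleton] at this
    rcases this with rfl | rfl | rfl | rfl
    exacts [⟨hvi', hwi'⟩, ⟨hvj', hwj'⟩, hc _ hak, hc _ hal]
  exact ⟨funext fun m => (hall m).1, funext fun m => (hall m).2⟩

/-- The vectors `v, w` are the basis of `W` that is dual to the coordinates `i, j`. -/
structure IsFrame {Ω : Type*} [Field Ω] (W : Submodule Ω (Fin 4 → Ω)) (i j : Fin 4)
    (v w : Fin 4 → Ω) : Prop where
  memLeft : v ∈ W
  memRight : w ∈ W
  left_i : v i = 1
  left_j : v j = 0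
  right_i : w i = 0
  right_j : w j = 1
  eq_add : ∀ x ∈ W, x = x i • v + x j • w

theorem IsFrame.unique {Ω : Type*} [Field Ω] {W : Submodule Ω (Fin 4 → Ω)} {i j : Fin 4}
    {v w v' w' : Fin 4 → Ω} (h : IsFrame W i j v w) (h' : IsFrame W i j v' w') :
    v = v' ∧ w = w' := by
  constructor
  · have := h.eq_add v' h'.memLeft
    rw [this, h'.left_i, h'.left_j]; simp
  · have := h.eq_add w' h'.memRight
    rw [this, h'.right_i, h'.right_j]; simp

theorem IsFrame.linearIndependent {Ω : Type*} [Field Ω] {W : Submodule Ω (Fin 4 → Ω)} {i j : Fin 4}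
    {v w : Fin 4 → Ω} (h : IsFrame W i j v w) : LinearIndependent Ω ![v, w] := by
  rw [LinearIndependent.pair_iff]
  intro s t hst
  have h1 := congrFun hst i
  have h2 := congrFun hst j
  simp [h.left_i, h.left_j, h.right_i, h.right_j] at h1 h2
  exact ⟨h1, h2⟩

theorem IsFrame.span_eq {Ω : Type*} [Field Ω] {W : Submodule Ω (Fin 4 → Ω)} {i j : Fin 4}
    {v w : Fin 4 → Ω} (h : IsFrame W i j v w) : Submodule.span Ω (Set.range ![v, w]) = W := by
  rw [Matrix.range_cons, Matrix.range_cons, Matrix.range_empty, Set.union_empty,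
    Set.singleton_union]
  refine le_antisymm (Submodule.span_le.mpr ?_) fun x hx => ?_
  · rintro x (rfl | rfl)
    exacts [h.memLeft, h.memRight]
  · exact Submodule.mem_span_pair.mpr ⟨x i, x j, (h.eq_add x hx).symm⟩

theorem exists_isFrame {Ω : Type*} [Field Ω] {W : Submodule Ω (Fin 4 → Ω)}
    (hW : Module.finrank Ω W = 2) : ∃ i j v w, IsFrame W i j v w := by
  obtain ⟨b⟩ : Nonempty (Module.Basis (Fin 2) Ω W) := ⟨Module.finBasisOfFinrankEq Ω W hW⟩
  have hW0 : ∀ (u : Fin 2 → W), LinearIndependent Ω u → Submodule.span Ω (Set.range u) = ⊤ :=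
    fun u hu => hu.span_eq_top_of_card_eq_finrank (by simp [hW])
  obtain ⟨x, hx⟩ : ∃ x : W, x ≠ 0 := ⟨b 0, b.ne_zero 0⟩
  obtain ⟨i, hi⟩ : ∃ i, x.1 i ≠ 0 := by
    by_contra! h
    exact hx (Subtype.ext (funext h))
  -- A coordinate cannot be injective on a plane; normalizing `y` and clearing its pivot from `x`
  -- gives the frame.
  obtain ⟨y, hy0, hyi⟩ : ∃ y : W, y ≠ 0 ∧ y.1 i = 0 := by
    by_contra! h
    have : Function.Injective ((LinearMap.proj i : (Fin 4 → Ω) →ₗ[Ω] Ω) ∘ₗ W.subtype) := by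
      rw [← LinearMap.ker_eq_bot, LinearMap.ker_eq_bot']
      intro m hm
      by_contra hm0
      exact h m hm0 hm
    have := LinearMap.finrank_le_finrank_of_injective this
    simp [hW] at this
  obtain ⟨j, hj⟩ : ∃ j, y.1 j ≠ 0 := by
    by_contra! h
    exact hy0 (Subtype.ext (funext h))
  let w : W := (y.1 j)⁻¹ • y
  let v : W := (x.1 i)⁻¹ • (x - x.1 j • w)
  have hwi : w.1 i = 0 := by simp [w, hyi]
  have hwj : w.1 j = 1 := by simp [w, hj]
  have hvi : v.1 i = 1 := by simp [v, hwi, hi]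
  have hvj : v.1 j = 0 := by simp [v, hwj]
  have hli : LinearIndependent Ω ![v, w] := by
    rw [LinearIndependent.pair_iff]
    intro s t hst
    have h1 := congrFun (congrArg Subtype.val hst) i
    have h2 := congrFun (congrArg Subtype.val hst) j
    simp [hvi, hvj, hwi, hwj] at h1 h2
    exact ⟨h1, h2⟩
  refine ⟨i, j, v, w, v.2, w.2, hvi, hvj, hwi, hwj, fun z hz => ?_⟩
  have hmem : (⟨z, hz⟩ : W) ∈ Submodule.span Ω (Set.range ![v, w]) := hW0 _ hli ▸ trivial
  rw [Matrix.range_cons, Matrix.range_cons, Matrix.range_empty, Set.union_empty,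
    Set.singleton_union, Submodule.mem_span_pair] at hmem
  obtain ⟨a, c, hac⟩ := hmem
  have hz' : a • v.1 + c • w.1 = z := congrArg Subtype.val hac
  have h1 : z i = a := by rw [← hz']; simp [hvi, hwi]
  have h2 : z j = c := by rw [← hz']; simp [hvj, hwj]
  rw [h1, h2, hz']

/-- The form `F` at the point `s v + t w`, as a polynomial in the coordinates of `v, w`. -/
noncomputable def formOnLine {k Ω : Type*} [CommRing k] [Field Ω] [Algebra k Ω]
    (F : MvPolynomial (Fin 4) k) (s t : Ω) : MvPolynomial (Fin 2 × Fin 4) Ω :=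
  MvPolynomial.aeval (fun m => MvPolynomial.C s * MvPolynomial.X (0, m) +
    MvPolynomial.C t * MvPolynomial.X (1, m)) F

theorem eval_formOnLine {k Ω : Type*} [CommRing k] [Field Ω] [Algebra k Ω]
    (F : MvPolynomial (Fin 4) k) (s t : Ω) (x : Fin 2 × Fin 4 → Ω) :
    MvPolynomial.eval x (formOnLine F s t) =
      MvPolynomial.aeval (fun m => s * x (0, m) + t * x (1, m)) F := by
  have := MvPolynomial.comp_aeval_apply (fun m : Fin 4 => (MvPolynomial.C s * MvPolynomial.X (0, m) +
    MvPolynomial.C t * MvPolynomial.X (1, m) : MvPolynomial (Fin 2 × Fin 4) Ω))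
    ((MvPolynomial.aeval x : MvPolynomial (Fin 2 × Fin 4) Ω →ₐ[Ω] Ω).restrictScalars k) F
  refine ((MvPolynomial.aeval_eq_eval x).symm ▸ this).trans ?_
  congr 2
  funext m
  simp

theorem sum_eval_pderiv_formOnLine {k Ω : Type*} [CommRing k] [Field Ω] [Algebra k Ω]
    (F : MvPolynomial (Fin 4) k) (s t : Ω) (x y : Fin 2 × Fin 4 → Ω) :
    ∑ a, MvPolynomial.eval x (MvPolynomial.pderiv a (formOnLine F s t)) * y a =
      ∑ m, MvPolynomial.aeval (fun m => s * x (0, m) + t * x (1, m)) (MvPolynomial.pderiv m F) *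
        (s * y (0, m) + t * y (1, m)) := by
  let ψ : MvPolynomial (Fin 2 × Fin 4) Ω →ₐ[Ω] DualNumber Ω :=
    MvPolynomial.aeval fun i => TrivSqZeroExt.inl (x i) + TrivSqZeroExt.inr (y i)
  have h1 : ψ (formOnLine F s t) = _ := aeval_dualNumber x y (formOnLine F s t)
  have h2 := MvPolynomial.comp_aeval_apply (fun m : Fin 4 => (MvPolynomial.C s * MvPolynomial.X (0, m) +
    MvPolynomial.C t * MvPolynomial.X (1, m) : MvPolynomial (Fin 2 × Fin 4) Ω))
    (ψ.restrictScalars k) F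
  have h3 := aeval_dualNumber (fun m => s * x (0, m) + t * x (1, m))
    (fun m => s * y (0, m) + t * y (1, m)) F
  have h4 : ∀ a : Ω, ψ (MvPolynomial.C a) = TrivSqZeroExt.inl a := fun a => ψ.commutes a
  have h6 : ∀ a, ψ (MvPolynomial.X a) = TrivSqZeroExt.inl (x a) + TrivSqZeroExt.inr (y a) :=
    fun a => MvPolynomial.aeval_X _ a
  have h5 : (fun m : Fin 4 => (ψ.restrictScalars k)
      (MvPolynomial.C s * MvPolynomial.X (0, m) + MvPolynomial.C t * MvPolynomial.X (1, m))) =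
      fun m => (TrivSqZeroExt.inl (s * x (0, m) + t * x (1, m)) +
        TrivSqZeroExt.inr (s * y (0, m) + t * y (1, m)) : DualNumber Ω) := by
    funext m
    rw [AlgHom.restrictScalars_apply, map_add, map_mul, map_mul, h4, h4, h6, h6]
    simp [TrivSqZeroExt.ext_iff]
  rw [h5, h3] at h2
  have h6 := congrArg TrivSqZeroExt.snd (h1.symm.trans h2)
  simpa only [TrivSqZeroExt.snd_add, TrivSqZeroExt.snd_inl, TrivSqZeroExt.snd_inr, zero_add,
    MvPolynomial.aeval_eq_eval] using h6

/-- The equations of the pairs `v, w` that are a frame, with respect to the coordinates `i, j`, of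
a line on `F = 0`. -/
def frameEquations {k : Type*} (Ω : Type*) [CommRing k] [Field Ω] [Algebra k Ω]
    (F : MvPolynomial (Fin 4) k) (i j : Fin 4) : Set (MvPolynomial (Fin 2 × Fin 4) Ω) :=
  {MvPolynomial.X (0, i) - 1, MvPolynomial.X (0, j), MvPolynomial.X (1, i),
    MvPolynomial.X (1, j) - 1} ∪ Set.range fun st : Ω × Ω => formOnLine F st.1 st.2

theorem finite_zeros_frameEquations {k Ω : Type*} [CommRing k] [Field Ω] [IsAlgClosed Ω]
    [Algebra k Ω] {F : MvPolynomial (Fin 4) k} (hF : IsSmoothQuartic F Ω) (i j : Fin 4) :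
    {x : Fin 2 × Fin 4 → Ω | ∀ f ∈ frameEquations Ω F i j, MvPolynomial.eval x f = 0}.Finite := by
  classical
  refine finite_zeros_of_tangent_eq_zero _ fun x y hx hy => ?_
  have hsum : ∀ a : Fin 2 × Fin 4, ∑ b, MvPolynomial.eval x (MvPolynomial.pderiv b
      (MvPolynomial.X a : MvPolynomial (Fin 2 × Fin 4) Ω)) * y b = y a := by
    intro a
    rw [Finset.sum_eq_single a]
    · simp
    · intro b _ hb
      rw [MvPolynomial.pderiv_X_of_ne hb.symm, map_zero, zero_mul]
    · simp
  have hsum' : ∀ a : Fin 2 × Fin 4, ∑ b, MvPolynomial.eval x (MvPolynomial.pderiv b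
      (MvPolynomial.X a - 1 : MvPolynomial (Fin 2 × Fin 4) Ω)) * y b = y a := by
    intro a
    simp only [map_sub, MvPolynomial.pderiv_one, sub_zero]
    exact hsum a
  have a1 := hx _ (Or.inl (Or.inl rfl))
  have a2 := hx _ (Or.inl (Or.inr (Or.inl rfl)))
  have a3 := hx _ (Or.inl (Or.inr (Or.inr (Or.inl rfl))))
  have a4 := hx _ (Or.inl (Or.inr (Or.inr (Or.inr rfl))))
  have b1 := (hsum' _).symm.trans (hy _ (Or.inl (Or.inl rfl)))
  have b2 := (hsum _).symm.trans (hy _ (Or.inl (Or.inr (Or.inl rfl))))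
  have b3 := (hsum _).symm.trans (hy _ (Or.inl (Or.inr (Or.inr (Or.inl rfl)))))
  have b4 := (hsum' _).symm.trans (hy _ (Or.inl (Or.inr (Or.inr (Or.inr rfl)))))
  simp only [map_sub, MvPolynomial.eval_X, map_one, sub_eq_zero] at a1 a2 a3 a4
  have c : ∀ s t : Ω, MvPolynomial.aeval (fun m => s * x (0, m) + t * x (1, m)) F = 0 := by
    intro s t
    rw [← eval_formOnLine]
    exact hx _ (Or.inr ⟨(s, t), rfl⟩)
  have d : ∀ s t : Ω, ∑ m, MvPolynomial.aeval (fun m => s * x (0, m) + t * x (1, m))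
      (MvPolynomial.pderiv m F) * (s * y (0, m) + t * y (1, m)) = 0 := by
    intro s t
    rw [← sum_eval_pderiv_formOnLine]
    exact hy _ (Or.inr ⟨(s, t), rfl⟩)
  obtain ⟨h0, h1⟩ := tangent_eq_zero (v' := fun m => y (0, m)) (w' := fun m => y (1, m))
    hF a1 a2 a3 a4 b1 b2 b3 b4 c d
  funext ⟨r, m⟩
  fin_cases r
  · exact congrFun h0 m
  · exact congrFun h1 m

theorem finite_linesOn {k Ω : Type*} [CommRing k] [Field Ω] [IsAlgClosed Ω] [Algebra k Ω]
    {F : MvPolynomial (Fin 4) k} (hF : IsSmoothQuartic F Ω) : (linesOn F Ω).Finite := by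
  let ℓ : (Fin 2 × Fin 4 → Ω) → Submodule Ω (Fin 4 → Ω) := fun x =>
    Submodule.span Ω (Set.range ![fun m => x (0, m), fun m => x (1, m)])
  have hfin : (⋃ i, ⋃ j, ℓ '' {x : Fin 2 × Fin 4 → Ω | ∀ f ∈ frameEquations Ω F i j,
      MvPolynomial.eval x f = 0}).Finite :=
    Set.finite_iUnion fun i => Set.finite_iUnion fun j =>
      (finite_zeros_frameEquations hF i j).image ℓ
  refine hfin.subset ?_
  rintro W ⟨hW, hWF⟩
  obtain ⟨i, j, v, w, h⟩ := exists_isFrame hW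
  simp only [Set.mem_iUnion]
  refine ⟨i, j, fun rm => ![v, w] rm.1 rm.2, ?_, h.span_eq⟩
  rintro f ((rfl | rfl | rfl | rfl) | ⟨⟨s, t⟩, rfl⟩)
  · simp [h.left_i]
  · simp [h.left_j]
  · simp [h.right_i]
  · simp [h.right_j]
  · rw [eval_formOnLine]
    exact hWF _ (W.add_mem (W.smul_mem s h.memLeft) (W.smul_mem t h.memRight))

/-! ### Galois conjugation of linear subspaces -/

section Galois

variable {k : Type*} [CommRing k] {Ω : Type*} [Field Ω] [Algebra k Ω]

/-- The conjugate `σ W` of a linear subspace. -/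
def galConj (σ : Ω ≃ₐ[k] Ω) (W : Submodule Ω (Fin 4 → Ω)) : Submodule Ω (Fin 4 → Ω) where
  carrier := {x | (fun i => σ.symm (x i)) ∈ W}
  add_mem' {x y} hx hy := by
    simp only [Set.mem_ofPred_eq, Pi.add_apply, map_add] at *
    exact W.add_mem hx hy
  zero_mem' := by
    simp only [Set.mem_ofPred_eq, Pi.zero_apply, map_zero]
    exact W.zero_mem
  smul_mem' c x hx := by
    simp only [Set.mem_ofPred_eq, Pi.smul_apply, smul_eq_mul, map_mul] at *
    exact W.smul_mem _ hx

theorem mem_galConj (σ : Ω ≃ₐ[k] Ω) (W : Submodule Ω (Fin 4 → Ω)) (x : Fin 4 → Ω) :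
    (fun i => σ (x i)) ∈ galConj σ W ↔ x ∈ W := by
  change (fun i => σ.symm (σ (x i))) ∈ W ↔ x ∈ W
  simp

theorem galConj_symm_galConj (σ : Ω ≃ₐ[k] Ω) (W : Submodule Ω (Fin 4 → Ω)) :
    galConj σ.symm (galConj σ W) = W := by
  ext x
  exact mem_galConj σ W x

theorem IsFrame.galConj {W : Submodule Ω (Fin 4 → Ω)} {i j : Fin 4} {v w : Fin 4 → Ω}
    (h : IsFrame W i j v w) (σ : Ω ≃ₐ[k] Ω) :
    IsFrame (galConj σ W) i j (fun m => σ (v m)) (fun m => σ (w m)) where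
  memLeft := (mem_galConj σ W v).mpr h.memLeft
  memRight := (mem_galConj σ W w).mpr h.memRight
  left_i := by simp [h.left_i]
  left_j := by simp [h.left_j]
  right_i := by simp [h.right_i]
  right_j := by simp [h.right_j]
  eq_add x hx := by
    have h1 := h.eq_add _ hx
    funext m
    have h2 := congrArg σ (congrFun h1 m)
    simpa using h2

/-- A pair of coordinates of which a line `W` has a dual basis. -/
noncomputable def pivot (W : Submodule Ω (Fin 4 → Ω)) : Fin 4 × Fin 4 :=
  Classical.epsilon fun ij => ∃ v w, IsFrame W ij.1 ij.2 v w

/-- The basis of the line `W` that is dual to its pivot. -/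
noncomputable def frame (W : Submodule Ω (Fin 4 → Ω)) : Fin 2 → Fin 4 → Ω :=
  Classical.epsilon fun u => IsFrame W (pivot W).1 (pivot W).2 (u 0) (u 1)

theorem isFrame_frame {W : Submodule Ω (Fin 4 → Ω)} (hW : Module.finrank Ω W = 2) :
    IsFrame W (pivot W).1 (pivot W).2 (frame W 0) (frame W 1) := by
  obtain ⟨i, j, v, w, h⟩ := exists_isFrame hW
  have h1 : ∃ ij : Fin 4 × Fin 4, ∃ v w, IsFrame W ij.1 ij.2 v w := ⟨(i, j), v, w, h⟩
  obtain ⟨v', w', h2⟩ := Classical.epsilon_spec h1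
  have h3 : ∃ u : Fin 2 → Fin 4 → Ω, IsFrame W (pivot W).1 (pivot W).2 (u 0) (u 1) :=
    ⟨![v', w'], h2⟩
  exact Classical.epsilon_spec h3

/-- The choice by `Classical.epsilon` depends only on the predicate, and conjugation carries frames
to frames with the same pair of coordinates. -/
theorem pivot_galConj (σ : Ω ≃ₐ[k] Ω) (W : Submodule Ω (Fin 4 → Ω)) :
    pivot (galConj σ W) = pivot W := by
  unfold pivot
  congr 1
  funext ij
  refine propext ⟨?_, ?_⟩
  · rintro ⟨v, w, h⟩
    have := h.galConj σ.symm
    rw [galConj_symm_galConj] at this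
    exact ⟨_, _, this⟩
  · rintro ⟨v, w, h⟩
    exact ⟨_, _, h.galConj σ⟩

theorem finrank_eq_two_of_isFrame {W : Submodule Ω (Fin 4 → Ω)} {i j : Fin 4} {v w : Fin 4 → Ω}
    (h : IsFrame W i j v w) : Module.finrank Ω W = 2 := by
  have := finrank_span_eq_card h.linearIndependent
  rwa [h.span_eq, Fintype.card_fin] at this

theorem finrank_galConj (σ : Ω ≃ₐ[k] Ω) {W : Submodule Ω (Fin 4 → Ω)}
    (hW : Module.finrank Ω W = 2) : Module.finrank Ω (galConj σ W) = 2 :=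
  finrank_eq_two_of_isFrame ((isFrame_frame hW).galConj σ)

theorem frame_galConj (σ : Ω ≃ₐ[k] Ω) {W : Submodule Ω (Fin 4 → Ω)}
    (hW : Module.finrank Ω W = 2) (r : Fin 2) (m : Fin 4) :
    frame (galConj σ W) r m = σ (frame W r m) := by
  have h1 := isFrame_frame (finrank_galConj σ hW)
  have h2 := (isFrame_frame hW).galConj σ
  rw [pivot_galConj] at h1
  obtain ⟨e0, e1⟩ := h1.unique h2
  fin_cases r
  · exact congrFun e0 m
  · exact congrFun e1 m

theorem span_frame {W : Submodule Ω (Fin 4 → Ω)} (hW : Module.finrank Ω W = 2) :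
    Submodule.span Ω (Set.range (frame W)) = W := by
  have h := (isFrame_frame hW).span_eq
  have h2 : frame W = ![frame W 0, frame W 1] := by
    funext r; fin_cases r <;> rfl
  rw [h2]; exact h

theorem linearIndependent_frame {W : Submodule Ω (Fin 4 → Ω)} (hW : Module.finrank Ω W = 2) :
    LinearIndependent Ω (frame W) := by
  have h := (isFrame_frame hW).linearIndependent
  have h2 : frame W = ![frame W 0, frame W 1] := by
    funext r; fin_cases r <;> rfl
  rw [h2]; exact h

theorem galConj_mem_linesOn (σ : Ω ≃ₐ[k] Ω) {F : MvPolynomial (Fin 4) k}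
    {W : Submodule Ω (Fin 4 → Ω)} (hW : W ∈ linesOn F Ω) : galConj σ W ∈ linesOn F Ω := by
  refine ⟨finrank_galConj σ hW.1, fun x hx => ?_⟩
  have h1 := hW.2 _ hx
  have h2 := MvPolynomial.comp_aeval_apply (fun i => σ.symm (x i)) (σ : Ω →ₐ[k] Ω) F
  rw [h1, map_zero] at h2
  simpa using h2.symm

end Galois

/-! ### Separating linear forms and descent of polynomials -/

/-- Coefficients on the moment curve, `a j = t ^ e j`, fail to separate a given pair only when `t`
is a root of a nonzero polynomial. Natural numbers are used because Galois fixes them. -/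
theorem exists_natCast_separating {ι κ Ω : Type*} [Finite ι] [Fintype κ] [Field Ω] [CharZero Ω]
    (c : ι → κ → Ω) (hc : Function.Injective c) :
    ∃ a : κ → ℕ, Function.Injective fun i => ∑ j, (a j : Ω) * c i j := by
  classical
  have := Fintype.ofFinite ι
  let e := Fintype.equivFin κ
  let P : ι × ι → Polynomial Ω := fun p =>
    ∑ j, Polynomial.C (c p.1 j - c p.2 j) * Polynomial.X ^ (e j : ℕ)
  have hP : ∀ p : ι × ι, p.1 ≠ p.2 → P p ≠ 0 := by
    intro p hp h0
    obtain ⟨j, hj⟩ := Function.ne_iff.mp (hc.ne hp)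
    have h1 := congrArg (Polynomial.coeff · (e j : ℕ)) h0
    simp only [P, Polynomial.finsetSum_coeff, Polynomial.coeff_C_mul, Polynomial.coeff_X_pow,
      Polynomial.coeff_zero, Fin.val_inj, e.injective.eq_iff, mul_ite, mul_one, mul_zero,
      Finset.sum_ite_eq, Finset.mem_univ, if_true] at h1
    exact hj (sub_eq_zero.mp h1)
  let Q : Polynomial Ω := ∏ p ∈ Finset.univ.filter (fun p : ι × ι => p.1 ≠ p.2), P p
  have hQ : Q ≠ 0 := Finset.prod_ne_zero_iff.mpr fun p hp => hP p (Finset.mem_filter.mp hp).2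
  obtain ⟨t, ht⟩ : ∃ t : ℕ, Q.eval (t : Ω) ≠ 0 := by
    by_contra! h
    refine hQ (Polynomial.eq_zero_of_infinite_isRoot Q ?_)
    exact (Set.infinite_range_of_injective (Nat.cast_injective (R := Ω))).mono
      (by rintro _ ⟨t, rfl⟩; exact h t)
  refine ⟨fun j => t ^ (e j : ℕ), fun i i' hii => ?_⟩
  by_contra hne
  rw [Polynomial.eval_prod] at ht
  refine Finset.prod_ne_zero_iff.mp ht (i, i') (by simpa using hne) ?_
  simp only [P, Polynomial.eval_finsetSum, Polynomial.eval_mul, Polynomial.eval_C,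
    Polynomial.eval_pow, Polynomial.eval_X]
  have : ∑ j, (((t ^ (e j : ℕ) : ℕ) : Ω) * c i j - ((t ^ (e j : ℕ) : ℕ) : Ω) * c i' j) = 0 := by
    rw [Finset.sum_sub_distrib, sub_eq_zero]; exact hii
  rw [← this]
  refine Finset.sum_congr rfl fun j _ => ?_
  push_cast
  ring

section Descent

variable {K : Type*} [Field K] {Kbar : Type*} [Field Kbar] [Algebra K Kbar]

theorem exists_map_eq_of_fixed [IsGalois K Kbar] (P : Polynomial Kbar)
    (hP : ∀ σ : Kbar ≃ₐ[K] Kbar, P.map (σ : Kbar →+* Kbar) = P) :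
    ∃ Q : Polynomial K, Q.map (algebraMap K Kbar) = P := by
  refine (Polynomial.mem_lifts P).mp ((Polynomial.lifts_iff_coeff_lifts P).mpr fun n => ?_)
  rw [InfiniteGalois.mem_range_algebraMap_iff_fixed]
  intro σ
  conv_rhs => rw [← hP σ]
  simp

theorem prod_X_sub_C_map {ι : Type*} [Fintype ι] (a : ι → Kbar) (σ : Kbar ≃ₐ[K] Kbar)
    (e : ι ≃ ι) (h : ∀ i, σ (a i) = a (e i)) :
    (∏ i, (Polynomial.X - Polynomial.C (a i))).map (σ : Kbar →+* Kbar) =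
      ∏ i, (Polynomial.X - Polynomial.C (a i)) := by
  rw [Polynomial.map_prod, ← e.prod_comp fun i => Polynomial.X - Polynomial.C (a i)]
  refine Finset.prod_congr rfl fun i _ => ?_
  simp [h]

end Descent

/-- Lines correspond equivariantly to the values `α`, which are the roots of a separable polynomial
`g` over `K`; geometric points of `AdjoinRoot g` are the same roots. -/
theorem exists_schemeOfLines {K : Type u} [Field K] [CharZero K] {Kbar : Type v} [Field Kbar]
    [Algebra K Kbar] [IsAlgClosure K Kbar] {F : MvPolynomial (Fin 4) K}
    (hF : IsSmoothQuartic F Kbar) : Nonempty (SchemeOfLines F Kbar) := by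
  classical
  have hac : IsAlgClosed Kbar := IsAlgClosure.isAlgClosed K
  have halg : Algebra.IsAlgebraic K Kbar := IsAlgClosure.isAlgebraic
  have hgal : IsGalois K Kbar := IsAlgClosure.isGalois K Kbar
  have hchar : CharZero Kbar := charZero_of_injective_algebraMap (algebraMap K Kbar).injective
  have hfin : Finite (linesOn F Kbar) := finite_linesOn hF
  have := Fintype.ofFinite (linesOn F Kbar)
  obtain ⟨a, ha⟩ := exists_natCast_separating
    (fun (W : linesOn F Kbar) (rm : Fin 2 × Fin 4) => frame W.1 rm.1 rm.2) (by
      intro W W' h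
      refine Subtype.ext ?_
      rw [← span_frame W.2.1, ← span_frame W'.2.1]
      congr 2
      funext r m
      exact congrFun h (r, m))
  let α : linesOn F Kbar → Kbar := fun W => ∑ rm : Fin 2 × Fin 4, (a rm : Kbar) * frame W.1 rm.1 rm.2
  have hα : Function.Injective α := ha
  let act : (Kbar ≃ₐ[K] Kbar) → linesOn F Kbar → linesOn F Kbar := fun σ W =>
    ⟨galConj σ W.1, galConj_mem_linesOn σ W.2⟩
  have hact : ∀ σ W, σ (α W) = α (act σ W) := by
    intro σ W
    simp only [α, act, map_sum, map_mul, map_natCast, frame_galConj σ W.2.1]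
  let f : Polynomial Kbar := ∏ W, (Polynomial.X - Polynomial.C (α W))
  have hroot : ∀ z, f.eval z = 0 ↔ ∃ W, α W = z := by
    intro z
    rw [Polynomial.eval_prod, Finset.prod_eq_zero_iff]
    simp only [Finset.mem_univ, true_and, Polynomial.eval_sub, Polynomial.eval_X,
      Polynomial.eval_C, sub_eq_zero]
    exact exists_congr fun _ => eq_comm
  obtain ⟨g, hg⟩ := exists_map_eq_of_fixed (K := K) f fun σ => by
    refine prod_X_sub_C_map α σ ⟨act σ, act σ.symm, fun W => ?_, fun W => ?_⟩ (hact σ)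
    · exact hα (by rw [← hact, ← hact]; simp)
    · exact hα (by rw [← hact, ← hact]; simp)
  have hfsep : f.Separable := (Polynomial.separable_prod_X_sub_C_iff).mpr hα
  have hgsep : g.Separable := by
    rw [← Polynomial.separable_map (algebraMap K Kbar), hg]; exact hfsep
  have hgmonic : g.Monic := by
    refine Polynomial.monic_of_injective (algebraMap K Kbar).injective ?_
    rw [hg]; exact Polynomial.monic_prod_of_monic _ _ fun W _ => Polynomial.monic_X_sub_C _
  have hpg : ∀ p : AdjoinRoot g →ₐ[K] Kbar, f.eval (p (AdjoinRoot.root g)) = 0 := by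
    intro p
    rw [← hg, Polynomial.eval_map_algebraMap, Polynomial.aeval_algHom_apply, AdjoinRoot.aeval_eq,
      AdjoinRoot.mk_self, map_zero]
  choose line hline using fun p => (hroot _).mp (hpg p)
  refine ⟨{ B := AdjoinRoot g
            finite := hgmonic.finite_adjoinRoot
            isReduced := ?_
            η := fun p => (line p).1
            bijOn := ⟨fun p _ => (line p).2, ?_, ?_⟩
            equivariant := ?_ }⟩
  · exact (Ideal.isRadical_iff_quotient_reduced _).mp
      (isRadical_iff_span_singleton.mp hgsep.squarefree.isRadical)
  · intro p _ q _ hpq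
    refine AdjoinRoot.algHom_ext ?_
    rw [← hline p, ← hline q, Subtype.ext hpq]
  · intro W hW
    have hz : Polynomial.aeval (α ⟨W, hW⟩) g = 0 := by
      rw [← Polynomial.eval_map_algebraMap, hg]; exact (hroot _).mpr ⟨_, rfl⟩
    let p : AdjoinRoot g →ₐ[K] Kbar := AdjoinRoot.liftAlgHom g (Algebra.ofId K Kbar) _ hz
    refine ⟨p, trivial, ?_⟩
    have : line p = ⟨W, hW⟩ := hα ((hline p).trans (AdjoinRoot.liftAlgHom_root g _ _ hz))
    simp only [this]
  · intro σ p x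
    have : line ((σ : Kbar →ₐ[K] Kbar).comp p) = act σ (line p) :=
      hα (by rw [hline, ← hact, hline]; rfl)
    simp only [this]
    exact mem_galConj σ _ x

/-! ### Almost all valuation rings -/

section AlmostAll

variable {Ω : Type*} [Field Ω] [CharZero Ω]

/-- The filter of the sets of valuation rings of `Ω` that contain all those in which some positive
integer is invertible. -/
def almostAll (Ω : Type*) [Field Ω] [CharZero Ω] : Filter (ValuationSubring Ω) where
  sets := {S | ∃ D : ℕ, 0 < D ∧ ∀ A : ValuationSubring Ω, (D : Ω)⁻¹ ∈ A → A ∈ S}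
  univ_sets := ⟨1, one_pos, fun _ _ => trivial⟩
  sets_of_superset := fun ⟨D, hD, h⟩ hST => ⟨D, hD, fun A hA => hST (h A hA)⟩
  inter_sets := by
    rintro S T ⟨D, hD, h⟩ ⟨E, hE, h'⟩
    refine ⟨D * E, Nat.mul_pos hD hE, fun A hA => ⟨h A ?_, h' A ?_⟩⟩
    · have : (D : Ω)⁻¹ = (E : Ω) * ((D * E : ℕ) : Ω)⁻¹ := by
        have : (E : Ω) ≠ 0 := Nat.cast_ne_zero.mpr hE.ne'
        push_cast
        field_simp
      exact this ▸ A.mul_mem _ _ (natCast_mem A E) hA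
    · have : (E : Ω)⁻¹ = (D : Ω) * ((D * E : ℕ) : Ω)⁻¹ := by
        have : (D : Ω) ≠ 0 := Nat.cast_ne_zero.mpr hD.ne'
        push_cast
        field_simp
      exact this ▸ A.mul_mem _ _ (natCast_mem A D) hA

theorem eventually_almostAll {Q : ValuationSubring Ω → Prop} :
    (∀ᶠ A : ValuationSubring Ω in almostAll Ω, Q A) ↔
      ∃ D : ℕ, 0 < D ∧ ∀ A : ValuationSubring Ω, (D : Ω)⁻¹ ∈ A → Q A :=
  Iff.rfl

/-- Some nonzero integer multiple `n x` is integral, hence in every valuation ring, so it suffices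
to invert `|n|`. -/
theorem eventually_mem [Algebra.IsAlgebraic ℤ Ω] (x : Ω) : ∀ᶠ A : ValuationSubring Ω in almostAll Ω, x ∈ A := by
  obtain ⟨n, hn, hx⟩ := (Algebra.IsAlgebraic.isAlgebraic (R := ℤ) x).exists_integral_multiple
  refine eventually_almostAll.mpr ⟨n.natAbs, Int.natAbs_pos.mpr hn, fun A hA => ?_⟩
  have h1 : ((n.natAbs : ℤ) : Ω) * x ∈ A := by
    rcases Int.natAbs_eq n with h | h
    · rw [← h]
      simpa using mem_of_isIntegral A hx
    · have : ((n.natAbs : ℤ) : Ω) = -((n : ℤ) : Ω) := by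
        conv_rhs => rw [h]
        push_cast; ring
      rw [this]
      simpa using mem_of_isIntegral A hx
  have h2 : x = (n.natAbs : Ω)⁻¹ * (((n.natAbs : ℤ) : Ω) * x) := by
    have : (n.natAbs : Ω) ≠ 0 := Nat.cast_ne_zero.mpr (Int.natAbs_pos.mpr hn).ne'
    rw [Int.cast_natCast]
    field_simp
  exact h2 ▸ A.mul_mem _ _ hA h1

theorem eventually_forall_mem [Algebra.IsAlgebraic ℤ Ω] {ι : Type*} [Finite ι] (x : ι → Ω) :
    ∀ᶠ A : ValuationSubring Ω in almostAll Ω, ∀ i, x i ∈ A :=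
  Filter.eventually_all.mpr fun i => eventually_mem (x i)

/-! ### Reduction of linear subspaces -/

/-- The reduction of a linear subspace with respect to a valuation ring. -/
noncomputable def reduceAt {Ω : Type*} [Field Ω] (A : ValuationSubring Ω)
    (W : Submodule Ω (Fin 4 → Ω)) :
    Submodule (IsLocalRing.ResidueField A) (Fin 4 → IsLocalRing.ResidueField A) where
  carrier := {y | ∃ x : Fin 4 → A,
    (fun i => (x i : Ω)) ∈ W ∧ y = fun i => IsLocalRing.residue A (x i)}
  add_mem' := by
    rintro _ _ ⟨x, hx, rfl⟩ ⟨x', hx', rfl⟩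
    exact ⟨x + x', W.add_mem hx hx', by ext i; simp⟩
  zero_mem' := ⟨0, W.zero_mem, by ext i; simp⟩
  smul_mem' := by
    rintro c _ ⟨x, hx, rfl⟩
    obtain ⟨a, rfl⟩ := IsLocalRing.residue_surjective c
    exact ⟨a • x, W.smul_mem (a : Ω) hx, by ext i; simp⟩

theorem reduceAt_mono {Ω : Type*} [Field Ω] (A : ValuationSubring Ω)
    {U W : Submodule Ω (Fin 4 → Ω)} (h : U ≤ W) : reduceAt A U ≤ reduceAt A W := by
  rintro _ ⟨x, hx, rfl⟩
  exact ⟨x, h hx, rfl⟩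

/-- Take a left inverse `c` of the matrix `b`. Once its entries lie in `A`, integral vectors of the
span have integral coordinates, and the identity `c b = 1` survives reduction and gives
independence. -/
theorem eventually_reduceAt_span [Algebra.IsAlgebraic ℤ Ω] {n : ℕ} {b : Fin n → Fin 4 → Ω}
    (hb : LinearIndependent Ω b) : ∀ᶠ A : ValuationSubring Ω in almostAll Ω, ∀ b' : Fin n → Fin 4 → A,
      (∀ i m, (b' i m : Ω) = b i m) →
      LinearIndependent (IsLocalRing.ResidueField A) (fun i m => IsLocalRing.residue A (b' i m)) ∧
      reduceAt A (Submodule.span Ω (Set.range b)) = Submodule.span (IsLocalRing.ResidueField A)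
        (Set.range fun i m => IsLocalRing.residue A (b' i m)) := by
  classical
  obtain ⟨f, hf⟩ := (Fintype.linearCombination Ω b).exists_leftInverse_of_injective
    (LinearMap.ker_eq_bot.mpr (linearIndependent_iff_injective_fintypeLinearCombination.mp hb))
  let c : Fin n → Fin 4 → Ω := fun i m => f (Pi.single m 1) i
  have hfc : ∀ x i, f x i = ∑ m, c i m * x m := by
    intro x i
    conv_lhs => rw [← Finset.univ_sum_single x]
    rw [map_sum, Finset.sum_apply]
    refine Finset.sum_congr rfl fun m _ => ?_
    have : (Pi.single m (x m) : Fin 4 → Ω) = x m • Pi.single m 1 := by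
      rw [← Pi.single_smul]; simp
    simp [c, this, mul_comm]
  have hfb : ∀ a : Fin n → Ω, f (∑ j, a j • b j) = a := fun a => by
    have := LinearMap.congr_fun hf a
    simpa [Fintype.linearCombination_apply] using this
  filter_upwards [eventually_forall_mem fun im : Fin n × Fin 4 => c im.1 im.2] with A hA b' hb'
  let c' : Fin n → Fin 4 → A := fun i m => ⟨c i m, hA (i, m)⟩
  have key : ∀ x : Fin 4 → A, (fun i => (x i : Ω)) ∈ Submodule.span Ω (Set.range b) →
      ∀ m, x m = ∑ i, (∑ m', c' i m' * x m') * b' i m := by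
    intro x hx m
    obtain ⟨a, ha⟩ := (Submodule.mem_span_range_iff_exists_fun Ω).mp hx
    have h1 : f (fun i => (x i : Ω)) = a := by rw [← ha, hfb]
    refine Subtype.ext ?_
    have h2 := (congrFun ha m).symm
    simp only [Finset.sum_apply, Pi.smul_apply, smul_eq_mul] at h2
    rw [h2]
    push_cast
    refine Finset.sum_congr rfl fun i _ => ?_
    rw [← h1, hfc, hb']
  have hcb : ∀ i j, ∑ m, c' i m * b' j m = if j = i then 1 else 0 := by
    intro i j
    refine Subtype.ext ?_
    push_cast
    simp only [hb']
    have h1 := hfb (Pi.single j 1)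
    have h2 : ∑ l, (Pi.single j 1 : Fin n → Ω) l • b l = b j := by
      rw [Finset.sum_eq_single j] <;> simp +contextual
    rw [h2] at h1
    have h3 := congrFun h1 i
    rw [hfc] at h3
    refine h3.trans ?_
    by_cases h : j = i
    · subst h; simp
    · simp [h, Ne.symm h]
  constructor
  · rw [Fintype.linearIndependent_iff]
    intro g hg i
    have h1 : ∀ m, ∑ j, g j * IsLocalRing.residue A (b' j m) = 0 := fun m => by
      simpa using congrFun hg m
    have h2 : ∑ m, IsLocalRing.residue A (c' i m) * ∑ j, g j * IsLocalRing.residue A (b' j m) = 0 :=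
      Finset.sum_eq_zero fun m _ => by rw [h1, mul_zero]
    simp only [Finset.mul_sum] at h2
    rw [Finset.sum_comm] at h2
    have h3 : ∀ j, ∑ m, IsLocalRing.residue A (c' i m) * (g j * IsLocalRing.residue A (b' j m)) =
        if j = i then g j else 0 := by
      intro j
      have := congrArg (IsLocalRing.residue A) (hcb i j)
      rw [map_sum] at this
      calc _ = g j * ∑ m, IsLocalRing.residue A (c' i m * b' j m) := by
            rw [Finset.mul_sum]
            exact Finset.sum_congr rfl fun m _ => by rw [map_mul]; ring
        _ = _ := by rw [this]; split_ifs <;> simp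
    simpa [h3] using h2
  · refine le_antisymm ?_ (Submodule.span_le.mpr ?_)
    · rintro _ ⟨x, hx, rfl⟩
      refine (Submodule.mem_span_range_iff_exists_fun _).mpr
        ⟨fun i => IsLocalRing.residue A (∑ m', c' i m' * x m'), ?_⟩
      funext m
      conv_rhs => rw [key x hx m]
      simp [Finset.sum_apply]
    · rintro _ ⟨i, rfl⟩
      refine ⟨b' i, ?_, rfl⟩
      simp only [hb']
      exact Submodule.subset_span ⟨i, rfl⟩

theorem exists_linearIndependent_span_eq {Ω : Type*} [Field Ω] (W : Submodule Ω (Fin 4 → Ω)) :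
    ∃ b : Fin (Module.finrank Ω W) → Fin 4 → Ω, LinearIndependent Ω b ∧
      Submodule.span Ω (Set.range b) = W := by
  let b := Module.finBasis Ω W
  refine ⟨fun i => (b i : Fin 4 → Ω), b.linearIndependent.map' W.subtype (Submodule.ker_subtype W), ?_⟩
  have : Set.range (fun i => (b i : Fin 4 → Ω)) = W.subtype '' Set.range b := by
    rw [← Set.range_comp]; rfl
  rw [this, Submodule.span_image, b.span_eq, Submodule.map_top, Submodule.range_subtype]

theorem eventually_finrank_reduceAt [Algebra.IsAlgebraic ℤ Ω] (W : Submodule Ω (Fin 4 → Ω)) :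
    ∀ᶠ A : ValuationSubring Ω in almostAll Ω,
      Module.finrank (IsLocalRing.ResidueField A) (reduceAt A W) = Module.finrank Ω W := by
  obtain ⟨b, hb, hW⟩ := exists_linearIndependent_span_eq W
  filter_upwards [eventually_reduceAt_span hb,
    eventually_forall_mem fun im : Fin (Module.finrank Ω W) × Fin 4 => b im.1 im.2] with A h1 h2
  obtain ⟨h3, h4⟩ := h1 (fun i m => ⟨b i m, h2 (i, m)⟩) fun _ _ => rfl
  rw [hW] at h4
  rw [h4, finrank_span_eq_card h3, Fintype.card_fin]

/-- Fix a decomposition `u + w` of each vector of a basis of the sum; it reduces termwise when the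
summands are integral. -/
theorem eventually_reduceAt_sup_le [Algebra.IsAlgebraic ℤ Ω] (U W : Submodule Ω (Fin 4 → Ω)) :
    ∀ᶠ A : ValuationSubring Ω in almostAll Ω, reduceAt A (U ⊔ W) ≤ reduceAt A U ⊔ reduceAt A W := by
  obtain ⟨b, hb, hUW⟩ := exists_linearIndependent_span_eq (U ⊔ W)
  have hmem : ∀ i, ∃ u ∈ U, ∃ w ∈ W, u + w = b i := fun i =>
    Submodule.mem_sup.mp (hUW ▸ Submodule.subset_span ⟨i, rfl⟩)
  choose u hu w hw huw using hmem
  filter_upwards [eventually_reduceAt_span hb,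
    eventually_forall_mem fun im : Fin (Module.finrank Ω ↥(U ⊔ W)) × Fin 4 => u im.1 im.2,
    eventually_forall_mem fun im : Fin (Module.finrank Ω ↥(U ⊔ W)) × Fin 4 => w im.1 im.2]
    with A h1 h2 h3
  let u' : Fin (Module.finrank Ω ↥(U ⊔ W)) → Fin 4 → A := fun i m => ⟨u i m, h2 (i, m)⟩
  let w' : Fin (Module.finrank Ω ↥(U ⊔ W)) → Fin 4 → A := fun i m => ⟨w i m, h3 (i, m)⟩
  obtain ⟨-, h4⟩ := h1 (fun i m => u' i m + w' i m) fun i m => congrFun (huw i) m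
  rw [hUW] at h4
  rw [h4, Submodule.span_le]
  rintro _ ⟨i, rfl⟩
  exact Submodule.mem_sup.mpr ⟨_, ⟨u' i, hu i, rfl⟩, _, ⟨w' i, hw i, rfl⟩, by funext m; simp⟩

/-- One inclusion always holds; the dimension formula for sum and intersection, before and after
reduction, forces equality. -/
theorem eventually_reduceAt_inf [Algebra.IsAlgebraic ℤ Ω] (U W : Submodule Ω (Fin 4 → Ω)) :
    ∀ᶠ A : ValuationSubring Ω in almostAll Ω, reduceAt A (U ⊓ W) = reduceAt A U ⊓ reduceAt A W := by
  filter_upwards [eventually_reduceAt_sup_le U W, eventually_finrank_reduceAt U,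
    eventually_finrank_reduceAt W, eventually_finrank_reduceAt (U ⊔ W),
    eventually_finrank_reduceAt (U ⊓ W)] with A h1 h2 h3 h4 h5
  have h6 : reduceAt A (U ⊔ W) = reduceAt A U ⊔ reduceAt A W :=
    le_antisymm h1 (sup_le (reduceAt_mono A le_sup_left) (reduceAt_mono A le_sup_right))
  have h7 := Submodule.finrank_sup_add_finrank_inf_eq (reduceAt A U) (reduceAt A W)
  have h8 := Submodule.finrank_sup_add_finrank_inf_eq U W
  rw [← h6] at h7
  exact Submodule.eq_of_le_of_finrank_eq
    (le_inf (reduceAt_mono A inf_le_left) (reduceAt_mono A inf_le_right)) (by omega)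

end AlmostAll

/-! ### Reduction and incidence graphs -/

section Graph

variable {Ω k : Type*} [Field Ω] [Field k] {r : Submodule Ω (Fin 4 → Ω) → Submodule k (Fin 4 → k)}

/-- Preserving intersections and their ranks makes `r` reflect inclusions: if `r U ≤ r W`, then `U ⊓
W` has the rank of `U`. Hence no vertices merge and no incidences appear; every intersection point
of the image comes from one upstairs. -/
theorem exists_incidenceGraph_iso {L : Set (Submodule Ω (Fin 4 → Ω))}
    {L' : Set (Submodule k (Fin 4 → k))} (hL' : L' = r '' L)
    (hmono : ∀ U W, U ≤ W → r U ≤ r W)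
    (hrank : ∀ U ∈ L ∪ intersectionPoints L, Module.finrank k (r U) = Module.finrank Ω U)
    (hrankinf : ∀ U ∈ L ∪ intersectionPoints L, ∀ W ∈ L ∪ intersectionPoints L,
      Module.finrank k (r (U ⊓ W)) = Module.finrank Ω ↥(U ⊓ W))
    (hinf : ∀ U ∈ L ∪ intersectionPoints L, ∀ W ∈ L ∪ intersectionPoints L,
      r (U ⊓ W) = r U ⊓ r W) :
    ∃ φ : incidenceGraph L ≃g incidenceGraph L',
      (∀ q : intersectionPoints L, ∃ q' : intersectionPoints L',
        φ (Sum.inl q) = Sum.inl q' ∧ q'.1 = r q.1) ∧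
      (∀ l : L, ∃ l' : L', φ (Sum.inr l) = Sum.inr l' ∧ l'.1 = r l.1) := by
  subst hL'
  have hle : ∀ U ∈ L ∪ intersectionPoints L, ∀ W ∈ L ∪ intersectionPoints L,
      r U ≤ r W → U ≤ W := by
    intro U hU W hW h
    have h1 : r (U ⊓ W) = r U := by rw [hinf U hU W hW, inf_eq_left.mpr h]
    have h2 := hrankinf U hU W hW
    rw [h1, hrank U hU] at h2
    exact inf_eq_left.mp (Submodule.eq_of_le_of_finrank_eq inf_le_left h2.symm)
  have hinj : ∀ U ∈ L ∪ intersectionPoints L, ∀ W ∈ L ∪ intersectionPoints L,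
      r U = r W → U = W := fun U hU W hW h =>
    le_antisymm (hle U hU W hW h.le) (hle W hW U hU h.ge)
  have hpt : ∀ q ∈ intersectionPoints L, r q ∈ intersectionPoints (r '' L) := by
    intro q hq
    have hq' := hq
    obtain ⟨h1, l₁, hl₁, l₂, hl₂, hne, rfl⟩ := hq'
    exact ⟨(hrank _ (Or.inr hq)).trans h1, r l₁, ⟨l₁, hl₁, rfl⟩, r l₂, ⟨l₂, hl₂, rfl⟩,
      fun h => hne (hinj _ (Or.inl hl₁) _ (Or.inl hl₂) h), hinf _ (Or.inl hl₁) _ (Or.inl hl₂)⟩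
  let f : intersectionPoints L → intersectionPoints (r '' L) := fun q => ⟨r q.1, hpt q.1 q.2⟩
  let g : L → r '' L := fun l => ⟨r l.1, l.1, l.2, rfl⟩
  have hf : Function.Bijective f := by
    constructor
    · intro q q' h
      exact Subtype.ext (hinj _ (Or.inr q.2) _ (Or.inr q'.2) (congrArg Subtype.val h))
    · rintro ⟨q', h1, _, ⟨l₁, hl₁, rfl⟩, _, ⟨l₂, hl₂, rfl⟩, hne, rfl⟩
      refine ⟨⟨l₁ ⊓ l₂, ?_, l₁, hl₁, l₂, hl₂, fun h => hne (h ▸ rfl), rfl⟩,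
        Subtype.ext (hinf _ (Or.inl hl₁) _ (Or.inl hl₂))⟩
      rw [← hrankinf _ (Or.inl hl₁) _ (Or.inl hl₂), hinf _ (Or.inl hl₁) _ (Or.inl hl₂), h1]
  have hg : Function.Bijective g := by
    constructor
    · intro l l' h
      exact Subtype.ext (hinj _ (Or.inl l.2) _ (Or.inl l'.2) (congrArg Subtype.val h))
    · rintro ⟨_, l, hl, rfl⟩
      exact ⟨⟨l, hl⟩, rfl⟩
  let e : (intersectionPoints L ⊕ L) ≃ (intersectionPoints (r '' L) ⊕ (r '' L : Set _)) :=
    Equiv.sumCongr (Equiv.ofBijective f hf) (Equiv.ofBijective g hg)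
  refine ⟨⟨e, ?_⟩, fun q => ⟨f q, rfl, rfl⟩, fun l => ⟨g l, rfl, rfl⟩⟩
  rintro (q | l) (q' | l')
  · exact Iff.rfl
  · exact ⟨hle _ (Or.inr q.2) _ (Or.inl l'.2), hmono _ _⟩
  · exact ⟨hle _ (Or.inr q'.2) _ (Or.inl l.2), hmono _ _⟩
  · exact Iff.rfl

theorem finite_intersectionPoints {L : Set (Submodule Ω (Fin 4 → Ω))} (hL : L.Finite) :
    (intersectionPoints L).Finite := by
  refine (Set.Finite.image2 (fun l₁ l₂ => l₁ ⊓ l₂) hL hL).subset ?_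
  rintro q ⟨-, l₁, h₁, l₂, h₂, -, rfl⟩
  exact ⟨l₁, h₁, l₂, h₂, rfl⟩

end Graph

/-- For almost all valuation rings, reduction is an isomorphism of the incidence graph of a finite
set of lines to that of its image. -/
theorem eventually_exists_incidenceGraph_iso {Ω : Type*} [Field Ω] [CharZero Ω]
    [Algebra.IsAlgebraic ℤ Ω] {L : Set (Submodule Ω (Fin 4 → Ω))} (hL : L.Finite) :
    ∀ᶠ A : ValuationSubring Ω in almostAll Ω, Set.InjOn (reduceAt A) L ∧ ∀ L', L' = reduceAt A '' L →
      ∃ φ : incidenceGraph L ≃g incidenceGraph L',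
      (∀ q : intersectionPoints L, ∃ q' : intersectionPoints L',
        φ (Sum.inl q) = Sum.inl q' ∧ q'.1 = reduceAt A q.1) ∧
      (∀ l : L, ∃ l' : L', φ (Sum.inr l) = Sum.inr l' ∧ l'.1 = reduceAt A l.1) := by
  have hT : (L ∪ intersectionPoints L).Finite := hL.union (finite_intersectionPoints hL)
  filter_upwards [(Filter.eventually_all_finite hT).mpr fun U _ => eventually_finrank_reduceAt U,
    (Filter.eventually_all_finite hT).mpr fun U _ => (Filter.eventually_all_finite hT).mpr fun W _ =>
      eventually_finrank_reduceAt (U ⊓ W),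
    (Filter.eventually_all_finite hT).mpr fun U _ => (Filter.eventually_all_finite hT).mpr fun W _ =>
      eventually_reduceAt_inf U W] with A h1 h2 h3
  have hiso : ∀ L', L' = reduceAt A '' L → _ := fun L' hL' =>
    exists_incidenceGraph_iso hL' (fun _ _ h => reduceAt_mono A h) h1 h2 h3
  refine ⟨fun l hl l' hl' h => ?_, hiso⟩
  -- Injectivity on lines is read off from the bijection on vertices.
  obtain ⟨φ, -, hφ⟩ := hiso _ rfl
  obtain ⟨m, hm, hm'⟩ := hφ ⟨l, hl⟩
  obtain ⟨n, hn, hn'⟩ := hφ ⟨l', hl'⟩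
  have : m = n := Subtype.ext (by rw [hm', hn']; exact h)
  have h4 := φ.injective (hm.trans (this ▸ hn.symm))
  exact congrArg Subtype.val (Sum.inr_injective h4)

/-- What holds for almost all valuation rings holds for the places above almost all primes. -/
theorem exists_forall_place_of_eventually {K : Type*} [Field K] {Kbar : Type*} [Field Kbar]
    [CharZero Kbar] [Algebra K Kbar] {Q : ValuationSubring Kbar → Prop}
    (hQ : ∀ᶠ A : ValuationSubring Kbar in almostAll Kbar, Q A) : ∃ D : ℕ, 0 < D ∧ ∀ p : ℕ, p.Prime → ¬ p ∣ D →
      ∀ (𝔭 : Ideal (𝓞 K)) [𝔭.IsMaximal], (p : 𝓞 K) ∈ 𝔭 →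
        ∀ P : PlaceOver Kbar 𝔭, Q P.ring := by
  obtain ⟨D, hD, h⟩ := eventually_almostAll.mp hQ
  refine ⟨D, hD, fun p hp hpD 𝔭 h𝔭 hmem => ?_⟩
  -- `p` and `D` are coprime integers, so a proper ideal cannot contain both. Outside `𝔭`, `D` is a
  -- unit at the place.
  have hD𝔭 : (D : 𝓞 K) ∉ 𝔭 := by
    intro hD𝔭
    obtain ⟨a, b, hab⟩ := Int.isCoprime_iff_gcd_eq_one.mpr
      ((Int.gcd_natCast_natCast p D).trans ((Nat.Prime.coprime_iff_not_dvd hp).mpr hpD))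
    refine h𝔭.ne_top ((Ideal.eq_top_iff_one _).mpr ?_)
    have h1 : (a : 𝓞 K) * (p : 𝓞 K) + (b : 𝓞 K) * (D : 𝓞 K) = 1 := by
      exact_mod_cast congrArg (Int.cast : ℤ → 𝓞 K) hab
    rw [← h1]
    exact 𝔭.add_mem (𝔭.mul_mem_left _ hmem) (𝔭.mul_mem_left _ hD𝔭)
  refine fun P => h _ ?_
  have h1 := mt (P.mem_iff (D : 𝓞 K)).mp hD𝔭
  rw [map_natCast, ValuationSubring.mem_nonunits_iff_or] at h1
  push Not at h1
  exact h1.2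

/-! ### Monogenic étale algebras -/

theorem etale_adjoinRoot {L : Type*} [CommRing L] {q : Polynomial L} (hq : q.Monic)
    (hsep : q.Separable) : Algebra.Etale L (AdjoinRoot q) := by
  obtain ⟨a, b, hab⟩ := hsep
  -- With inverted element `1` nothing is localized, so the standard étale ring is `AdjoinRoot q`
  -- itself.
  let P : StandardEtalePair L := ⟨q, hq, 1, b, a, 1, by rw [one_pow, ← hab]; ring⟩
  have h1 : P.HasMap (AdjoinRoot.root q) := ⟨by simp [P], by simp [P]⟩
  have h2 : q.eval₂ (Algebra.ofId L P.Ring) P.X = 0 := P.hasMap_X.1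
  refine Algebra.Etale.of_equiv (A := P.Ring) (AlgEquiv.ofAlgHom (P.lift (AdjoinRoot.root q) h1)
    (AdjoinRoot.liftAlgHom q (Algebra.ofId L P.Ring) P.X h2) ?_ ?_)
  · refine AdjoinRoot.algHom_ext ?_
    rw [AlgHom.comp_apply, AdjoinRoot.liftAlgHom_root, P.lift_X]
    rfl
  · refine P.hom_ext ?_
    rw [AlgHom.comp_apply, P.lift_X, AdjoinRoot.liftAlgHom_root]
    rfl

section Monogenic

variable {R : Type*} [CommRing R] {T : Type*} [CommRing T] [Algebra R T] {x : T} {f : Polynomial R}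

theorem algHom_ext_of_generator (hgen : ∀ t, ∃ h : Polynomial R, Polynomial.aeval x h = t)
    {E : Type*} [CommRing E] [Algebra R E] {φ ψ : T →ₐ[R] E} (h : φ x = ψ x) : φ = ψ := by
  ext t
  obtain ⟨g, rfl⟩ := hgen t
  rw [← Polynomial.aeval_algHom_apply, ← Polynomial.aeval_algHom_apply, h]

theorem exists_algEquiv_adjoinRoot (hgen : ∀ t, ∃ h : Polynomial R, Polynomial.aeval x h = t)
    (hf : Polynomial.aeval x f = 0) (hdvd : ∀ h : Polynomial R, Polynomial.aeval x h = 0 → f ∣ h) :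
    ∃ e : T ≃ₐ[R] AdjoinRoot f, e x = AdjoinRoot.root f := by
  let φ : AdjoinRoot f →ₐ[R] T := AdjoinRoot.liftAlgHom f (Algebra.ofId R T) x hf
  have hφ : ∀ h, φ (AdjoinRoot.mk f h) = Polynomial.aeval x h := fun h => rfl
  have hbij : Function.Bijective φ := by
    constructor
    · rw [injective_iff_map_eq_zero]
      intro a ha
      obtain ⟨h, rfl⟩ := AdjoinRoot.mk_surjective a
      exact AdjoinRoot.mk_eq_zero.mpr (hdvd h ha)
    · intro t
      obtain ⟨h, rfl⟩ := hgen t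
      exact ⟨AdjoinRoot.mk f h, rfl⟩
  refine ⟨(AlgEquiv.ofBijective φ hbij).symm, ?_⟩
  rw [AlgEquiv.symm_apply_eq]
  exact (AdjoinRoot.liftAlgHom_root f _ _ hf).symm

/-- The hypotheses present `T` as `R[X]/(f)`, so its base change is `L[X]/(f)`, where only the image
of `f` over `L` has to be separable. -/
theorem etale_tensorProduct (hgen : ∀ t, ∃ h : Polynomial R, Polynomial.aeval x h = t)
    (hf : Polynomial.aeval x f = 0) (hdvd : ∀ h : Polynomial R, Polynomial.aeval x h = 0 → f ∣ h)
    (L : Type*) [CommRing L] [Algebra R L] (hmonic : f.Monic)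
    (hsep : (f.map (algebraMap R L)).Separable) : Algebra.Etale L (L ⊗[R] T) := by
  have := etale_adjoinRoot (hmonic.map (algebraMap R L)) hsep
  obtain ⟨e, he⟩ := exists_algEquiv_adjoinRoot hgen hf hdvd
  let q := f.map (algebraMap R L)
  have h1 : f.eval₂ (Algebra.ofId R (AdjoinRoot q)) (AdjoinRoot.root q) = 0 := by
    have : Polynomial.aeval (AdjoinRoot.root q) q = 0 := by
      rw [AdjoinRoot.aeval_eq, AdjoinRoot.mk_self]
    rw [Polynomial.aeval_map_algebraMap] at this
    exact this
  have h2 : q.eval₂ (Algebra.ofId L (L ⊗[R] T)) ((1 : L) ⊗ₜ[R] x) = 0 := by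
    have : Polynomial.aeval (1 ⊗ₜ x : L ⊗[R] T) q = 0 := by
      rw [Polynomial.aeval_map_algebraMap]
      have := Polynomial.aeval_algHom_apply
        (Algebra.TensorProduct.includeRight : T →ₐ[R] L ⊗[R] T) x f
      rw [hf, map_zero] at this
      exact this
    exact this
  let α : T →ₐ[R] AdjoinRoot q := (AdjoinRoot.liftAlgHom f _ _ h1).comp (e : T →ₐ[R] AdjoinRoot f)
  have hα : α x = AdjoinRoot.root q := by
    change AdjoinRoot.liftAlgHom f _ _ h1 (e x) = _
    rw [he, AdjoinRoot.liftAlgHom_root]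
  let Φ : L ⊗[R] T →ₐ[L] AdjoinRoot q :=
    Algebra.TensorProduct.lift (Algebra.ofId L (AdjoinRoot q)) α fun _ _ => Commute.all _ _
  let Ψ : AdjoinRoot q →ₐ[L] L ⊗[R] T := AdjoinRoot.liftAlgHom q _ _ h2
  have hΦ : ∀ t, Φ (1 ⊗ₜ t) = α t := fun t => by simp [Φ]
  have hΨ : Ψ (AdjoinRoot.root q) = 1 ⊗ₜ x := AdjoinRoot.liftAlgHom_root q _ _ h2
  refine Algebra.Etale.of_equiv (AlgEquiv.ofAlgHom Ψ Φ ?_ ?_)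
  · refine Algebra.TensorProduct.ext (by ext) (algHom_ext_of_generator hgen ?_)
    change Ψ (Φ (1 ⊗ₜ x)) = 1 ⊗ₜ x
    rw [hΦ, hα, hΨ]
  · refine AdjoinRoot.algHom_ext ?_
    change Φ (Ψ _) = _
    rw [hΨ, hΦ, hα]
    rfl

end Monogenic

/-! ### Finite reduced algebras and their geometric points -/

section FiniteReduced

variable {K : Type u} [Field K] {Kbar : Type v} [Field Kbar] [Algebra K Kbar] {B : Type w}
  [CommRing B] [Algebra K B] [Module.Finite K B]

/-- A reduced finite algebra is a Jacobson ring with zero Jacobson radical, and every residue field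
embeds in `Kbar`. -/
theorem eq_zero_of_forall_algHom [IsAlgClosed Kbar] [IsReduced B] {b : B}
    (hb : ∀ p : B →ₐ[K] Kbar, p b = 0) : b = 0 := by
  have hJ : IsJacobsonRing B := isJacobsonRing_of_finiteType (A := K)
  have h0 : (⊥ : Ideal B).jacobson = ⊥ := hJ.out (Ideal.isRadical_bot)
  have : b ∈ (⊥ : Ideal B).jacobson := by
    rw [Ideal.jacobson, Ideal.mem_sInf]
    rintro m ⟨-, hm⟩
    let : Field (B ⧸ m) := Ideal.Quotient.field m
    have : Module.Finite K (B ⧸ m) := inferInstance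
    let φ : B ⧸ m →ₐ[K] Kbar := IsAlgClosed.lift
    have h1 := hb (φ.comp (Ideal.Quotient.mkₐ K m))
    have h2 : Ideal.Quotient.mk m b = 0 := φ.injective (by rw [map_zero]; exact h1)
    exact Ideal.Quotient.eq_zero_iff_mem.mp h2
  rwa [h0, Ideal.mem_bot] at this

theorem exists_separating_element [CharZero Kbar] :
    ∃ θ : B, Function.Injective fun p : B →ₐ[K] Kbar => p θ := by
  let b := Module.finBasis K B
  obtain ⟨a, ha⟩ := exists_natCast_separating (fun (p : B →ₐ[K] Kbar) j => p (b j)) fun p q h =>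
    AlgHom.toLinearMap_injective (b.ext fun j => congrFun h j)
  refine ⟨∑ j, (a j : B) * b j, fun p q h => ha ?_⟩
  simpa using h

/-- Conjugating the Lagrange interpolant of equivariant data gives a polynomial with the same values
and the same degree bound, hence the same polynomial; so its coefficients lie in `K`. -/
theorem exists_interpolating_polynomial [IsGalois K Kbar] {θ : B}
    (hθ : Function.Injective fun p : B →ₐ[K] Kbar => p θ) (c : (B →ₐ[K] Kbar) → Kbar)
    (hc : ∀ (σ : Kbar ≃ₐ[K] Kbar) (p : B →ₐ[K] Kbar), c ((σ : Kbar →ₐ[K] Kbar).comp p) = σ (c p)) :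
    ∃ g : Polynomial K, ∀ p : B →ₐ[K] Kbar, Polynomial.aeval (p θ) g = c p := by
  classical
  have := Fintype.ofFinite (B →ₐ[K] Kbar)
  let v : (B →ₐ[K] Kbar) → Kbar := fun p => p θ
  have hinj : Set.InjOn v (Finset.univ : Finset (B →ₐ[K] Kbar)) := hθ.injOn
  let P := Lagrange.interpolate Finset.univ v c
  have hP : ∀ p, P.eval (v p) = c p := fun p =>
    Lagrange.eval_interpolate_at_node c hinj (Finset.mem_univ p)
  obtain ⟨g, hg⟩ := exists_map_eq_of_fixed (K := K) P fun σ => by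
    refine Lagrange.eq_interpolate_of_eval_eq c hinj
      ((Polynomial.degree_map_le).trans_lt (Lagrange.degree_interpolate_lt c hinj)) fun p _ => ?_
    let p' : B →ₐ[K] Kbar := (σ.symm : Kbar →ₐ[K] Kbar).comp p
    have h1 : (σ : Kbar →ₐ[K] Kbar).comp p' = p := by ext; simp [p']
    have h2 : v p = (σ : Kbar →+* Kbar) (v p') := by simp [v, p']
    rw [h2, Polynomial.eval_map_apply, hP]
    exact (hc σ p').symm.trans (congrArg c h1)
  refine ⟨g, fun p => ?_⟩
  rw [← Polynomial.eval_map_algebraMap, hg]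
  exact hP p

end FiniteReduced

/-! ### Clearing denominators and integrality over a number field -/

section NumberField

variable {K : Type u} [Field K]

theorem algebraMap_ringOfIntegers_injective {Kbar : Type v} [Field Kbar] [Algebra K Kbar] :
    Function.Injective (algebraMap (𝓞 K) Kbar) := by
  rw [IsScalarTower.algebraMap_eq (𝓞 K) K Kbar]
  exact (algebraMap K Kbar).injective.comp NumberField.RingOfIntegers.coe_injective

theorem exists_map_eq_C_mul [NumberField K] {ι : Type*} [Finite ι] (g : ι → Polynomial K) :
    ∃ N : 𝓞 K, N ≠ 0 ∧ ∀ i, ∃ G : Polynomial (𝓞 K),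
      G.map (algebraMap (𝓞 K) K) = Polynomial.C (algebraMap (𝓞 K) K N) * g i := by
  classical
  have := Fintype.ofFinite ι
  choose b hb h using fun i => IsLocalization.integerNormalization_spec (nonZeroDivisors (𝓞 K)) (g i)
  refine ⟨∏ i, b i, Finset.prod_ne_zero_iff.mpr fun i _ => nonZeroDivisors.ne_zero (hb i),
    fun i => ?_⟩
  obtain ⟨m, hm⟩ := Finset.dvd_prod_of_mem b (Finset.mem_univ i)
  refine ⟨Polynomial.C m * IsLocalization.integerNormalization (nonZeroDivisors (𝓞 K)) (g i), ?_⟩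
  rw [Polynomial.map_mul, h, hm, Polynomial.map_C, ← algebraMap_smul K (b i) (g i),
    Polynomial.smul_eq_C_mul, map_mul, Polynomial.C_mul]
  ring

theorem exists_mvPolynomial_map_eq_C_mul [NumberField K] {ι σ : Type*} [Finite ι] (g : ι → MvPolynomial σ K) :
    ∃ N : 𝓞 K, N ≠ 0 ∧ ∀ i, ∃ G : MvPolynomial σ (𝓞 K),
      MvPolynomial.map (algebraMap (𝓞 K) K) G =
        MvPolynomial.C (algebraMap (𝓞 K) K N) * g i := by
  classical
  have := Fintype.ofFinite ι
  obtain ⟨N, hN⟩ := IsLocalization.exist_integer_multiples_of_finset (nonZeroDivisors (𝓞 K))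
    (Finset.univ.biUnion fun i => (g i).coeffs)
  refine ⟨N, nonZeroDivisors.ne_zero N.2, fun i => ?_⟩
  refine MvPolynomial.mem_range_map_iff_coeffs_subset.mpr ?_
  intro y hy
  obtain ⟨d, hd, rfl⟩ := MvPolynomial.mem_coeffs_iff.mp hy
  rw [MvPolynomial.coeff_C_mul]
  have hd0 : (g i).coeff d ≠ 0 := by
    intro h0
    rw [MvPolynomial.mem_support_iff, MvPolynomial.coeff_C_mul, h0, mul_zero] at hd
    exact hd rfl
  obtain ⟨z, hz⟩ := hN _ (Finset.mem_biUnion.mpr ⟨i, Finset.mem_univ i,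
    MvPolynomial.coeff_mem_coeffs d hd0⟩)
  exact ⟨z, hz.trans (Algebra.smul_def _ _)⟩

variable {Kbar : Type v} [Field Kbar] [Algebra K Kbar] {B : Type w} [CommRing B] [Algebra K B]

theorem exists_integral_separating_element [NumberField K] [Module.Finite K B] :
    ∃ θ : B, IsIntegral (𝓞 K) θ ∧ Function.Injective fun p : B →ₐ[K] Kbar => p θ := by
  have : CharZero Kbar := charZero_of_injective_algebraMap (algebraMap K Kbar).injective
  obtain ⟨θ, hθ⟩ := exists_separating_element (K := K) (Kbar := Kbar) (B := B)
  have halg : IsAlgebraic (𝓞 K) θ := (IsFractionRing.isAlgebraic_iff (𝓞 K) K B).mpr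
    (Algebra.IsAlgebraic.isAlgebraic θ)
  obtain ⟨y, hy, hintegral⟩ := halg.exists_integral_multiple
  refine ⟨y • θ, hintegral, fun p q h => hθ ?_⟩
  have hp : ∀ p : B →ₐ[K] Kbar, p (y • θ) = algebraMap (𝓞 K) Kbar y * p θ := fun p => by
    rw [← Algebra.smul_def]
    exact map_smul (p.restrictScalars (𝓞 K)) y θ
  have hy' : algebraMap (𝓞 K) Kbar y ≠ 0 := fun h0 =>
    hy (algebraMap_ringOfIntegers_injective (by rw [h0, map_zero]))
  change p (y • θ) = q (y • θ) at h
  rw [hp, hp] at h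
  exact mul_left_cancel₀ hy' h

/-- Galois permutes the roots, so the coefficients are in `K`; they are polynomials in integral
roots, so they are in `𝓞 K`. -/
theorem exists_integral_annihilator [IsGalois K Kbar] [Module.Finite K B] [Fintype (B →ₐ[K] Kbar)]
    {θ : B} (hintegral : IsIntegral (𝓞 K) θ) : ∃ f : Polynomial (𝓞 K), f.Monic ∧
      f.map (algebraMap (𝓞 K) Kbar) =
        ∏ p : B →ₐ[K] Kbar, (Polynomial.X - Polynomial.C (p θ)) := by
  have hpint : ∀ p : B →ₐ[K] Kbar, IsIntegral ℤ (p θ) := fun p =>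
    isIntegral_trans (R := ℤ) (A := 𝓞 K) _ (hintegral.map (p.restrictScalars (𝓞 K)))
  let S := integralClosure ℤ Kbar
  let P : Polynomial S := ∏ p : B →ₐ[K] Kbar, (Polynomial.X - Polynomial.C ⟨p θ, hpint p⟩)
  have hP : P.map (algebraMap S Kbar) = ∏ p : B →ₐ[K] Kbar, (Polynomial.X - Polynomial.C (p θ)) := by
    rw [Polynomial.map_prod]
    refine Finset.prod_congr rfl fun p _ => ?_
    rw [Polynomial.map_sub, Polynomial.map_X, Polynomial.map_C]
    rfl
  obtain ⟨Q, hQ⟩ := exists_map_eq_of_fixed (K := K)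
    (∏ p : B →ₐ[K] Kbar, (Polynomial.X - Polynomial.C (p θ))) fun σ =>
      prod_X_sub_C_map _ σ ⟨fun p => (σ : Kbar →ₐ[K] Kbar).comp p,
        fun p => (σ.symm : Kbar →ₐ[K] Kbar).comp p, fun p => by ext; simp, fun p => by ext; simp⟩
        fun p => rfl
  have hQint : ∀ n, IsIntegral ℤ (Q.coeff n) := by
    intro n
    have h1 : algebraMap K Kbar (Q.coeff n) = algebraMap S Kbar (P.coeff n) := by
      rw [← Polynomial.coeff_map, ← Polynomial.coeff_map, hQ, hP]
    have h2 : IsIntegral ℤ (algebraMap K Kbar (Q.coeff n)) := h1 ▸ (P.coeff n).2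
    exact (isIntegral_algebraMap_iff (algebraMap K Kbar).injective).mp h2
  obtain ⟨f, hf⟩ := (Polynomial.mem_lifts Q).mp ((Polynomial.lifts_iff_coeff_lifts
    (f := algebraMap (𝓞 K) K) Q).mpr fun n => ⟨⟨Q.coeff n, hQint n⟩, rfl⟩)
  have hmap : f.map (algebraMap (𝓞 K) Kbar) =
      ∏ p : B →ₐ[K] Kbar, (Polynomial.X - Polynomial.C (p θ)) := by
    rw [IsScalarTower.algebraMap_eq (𝓞 K) K Kbar, ← Polynomial.map_map, hf, hQ]
  refine ⟨f, Polynomial.monic_of_injective algebraMap_ringOfIntegers_injective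
    (?_ : (f.map (algebraMap (𝓞 K) Kbar)).Monic), hmap⟩
  rw [hmap]
  exact Polynomial.monic_prod_of_monic _ _ fun p _ => Polynomial.monic_X_sub_C _

theorem notMem_of_inv_mem {𝔭 : Ideal (𝓞 K)} (P : PlaceOver Kbar 𝔭) {x : 𝓞 K} (hx : x ≠ 0)
    (h : (algebraMap (𝓞 K) Kbar x)⁻¹ ∈ P.ring) : x ∉ 𝔭 := by
  intro hmem
  have h1 := (P.mem_iff x).mpr hmem
  rw [ValuationSubring.mem_nonunits_iff_or] at h1
  rcases h1 with h1 | h1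
  · exact hx (algebraMap_ringOfIntegers_injective (by rw [h1, map_zero]))
  · exact h1 h

theorem isAlgebraic_int [NumberField K] [Algebra.IsAlgebraic K Kbar] : Algebra.IsAlgebraic ℤ Kbar := by
  have h1 : Algebra.IsAlgebraic (𝓞 K) Kbar :=
    ⟨fun x => (IsFractionRing.isAlgebraic_iff (𝓞 K) K Kbar).mpr (Algebra.IsAlgebraic.isAlgebraic x)⟩
  exact Algebra.IsAlgebraic.trans ℤ (𝓞 K) Kbar

end NumberField

/-! ### The integral model generated by a separating element -/

section Model

variable {K : Type u} [Field K] {Kbar : Type v} [Field Kbar] [Algebra K Kbar] {B : Type w}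
  [CommRing B] [Algebra K B]

/-- The order `𝓞 K[θ]`, where `θ` is integral and generates `B` over `K`. -/
noncomputable def monogenicModel (θ : B) (hintegral : IsIntegral (𝓞 K) θ)
    (hgen : ∀ b : B, ∃ g : Polynomial K, Polynomial.aeval θ g = b) : IntegralModel K B where
  order := Algebra.adjoin (𝓞 K) {θ}
  finite := Algebra.finite_adjoin_simple_of_isIntegral hintegral
  span_eq_top := by
    rw [eq_top_iff]
    intro b _
    obtain ⟨g, rfl⟩ := hgen b
    rw [Polynomial.aeval_eq_sum_range]
    refine Submodule.sum_mem _ fun n _ => Submodule.smul_mem _ _ (Submodule.subset_span ?_)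
    exact (Algebra.adjoin (𝓞 K) {θ}).pow_mem (Algebra.subset_adjoin (Set.mem_singleton θ)) n

variable {θ : B} {hintegral : IsIntegral (𝓞 K) θ}
  {hgen : ∀ b : B, ∃ g : Polynomial K, Polynomial.aeval θ g = b}

/-- The generator of the order `𝓞 K[θ]`. -/
noncomputable def generator (θ : B) (hintegral : IsIntegral (𝓞 K) θ)
    (hgen : ∀ b : B, ∃ g : Polynomial K, Polynomial.aeval θ g = b) :
    (monogenicModel θ hintegral hgen).order :=
  ⟨θ, Algebra.subset_adjoin (Set.mem_singleton θ)⟩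

theorem coe_aeval_generator (h : Polynomial (𝓞 K)) :
    ((Polynomial.aeval (generator θ hintegral hgen) h : (monogenicModel θ hintegral hgen).order) : B) =
      Polynomial.aeval θ h :=
  (Polynomial.aeval_algHom_apply (monogenicModel θ hintegral hgen).order.val
    (generator θ hintegral hgen) h).symm

theorem exists_aeval_generator (t : (monogenicModel θ hintegral hgen).order) :
    ∃ h : Polynomial (𝓞 K), Polynomial.aeval (generator θ hintegral hgen) h = t := by
  have ht : t.1 ∈ Algebra.adjoin (𝓞 K) {θ} := t.2
  rw [Algebra.adjoin_singleton_eq_range_aeval] at ht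
  obtain ⟨h, hh⟩ := ht
  exact ⟨h, Subtype.ext ((coe_aeval_generator h).trans hh)⟩

theorem apply_aeval (p : B →ₐ[K] Kbar) (h : Polynomial (𝓞 K)) :
    p (Polynomial.aeval θ h) = (h.map (algebraMap (𝓞 K) Kbar)).eval (p θ) := by
  rw [Polynomial.eval_map_algebraMap]
  exact (Polynomial.aeval_algHom_apply (p.restrictScalars (𝓞 K)) θ h).symm

section Annihilator

variable [Fintype (B →ₐ[K] Kbar)] {f : Polynomial (𝓞 K)}

theorem aeval_generator_eq_zero [IsAlgClosed Kbar] [Module.Finite K B] [IsReduced B]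
    (hf : f.map (algebraMap (𝓞 K) Kbar) =
      ∏ p : B →ₐ[K] Kbar, (Polynomial.X - Polynomial.C (p θ))) :
    Polynomial.aeval (generator θ hintegral hgen) f = 0 := by
  refine Subtype.ext ((coe_aeval_generator f).trans ?_)
  refine eq_zero_of_forall_algHom (K := K) (Kbar := Kbar) fun p => ?_
  rw [apply_aeval, hf, Polynomial.eval_prod]
  exact Finset.prod_eq_zero (Finset.mem_univ p) (by simp)

/-- Since `f` is monic, divisibility may be tested over `Kbar`, where `f` is a product of distinct
linear factors and each `p θ` is a root of `h`. -/
theorem dvd_of_aeval_generator_eq_zero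
    (hθ : Function.Injective fun p : B →ₐ[K] Kbar => p θ) (hmonic : f.Monic)
    (hf : f.map (algebraMap (𝓞 K) Kbar) =
      ∏ p : B →ₐ[K] Kbar, (Polynomial.X - Polynomial.C (p θ))) (h : Polynomial (𝓞 K))
    (hh : Polynomial.aeval (generator θ hintegral hgen) h = 0) : f ∣ h := by
  rw [← Polynomial.map_dvd_map (algebraMap (𝓞 K) Kbar) algebraMap_ringOfIntegers_injective hmonic,
    hf]
  refine Finset.prod_dvd_of_coprime (fun p _ q _ hpq =>
    Polynomial.isCoprime_X_sub_C_of_isUnit_sub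
      (isUnit_iff_ne_zero.mpr (sub_ne_zero.mpr (hθ.ne hpq)))) fun p _ => ?_
  rw [Polynomial.dvd_iff_isRoot, Polynomial.IsRoot, ← apply_aeval, ← coe_aeval_generator (hintegral := hintegral)
    (hgen := hgen), hh]
  simp

theorem isSmoothAt_monogenicModel [IsAlgClosed Kbar] [Module.Finite K B] [IsReduced B]
    (hθ : Function.Injective fun p : B →ₐ[K] Kbar => p θ) (hmonic : f.Monic)
    (hf : f.map (algebraMap (𝓞 K) Kbar) =
      ∏ p : B →ₐ[K] Kbar, (Polynomial.X - Polynomial.C (p θ)))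
    {N : 𝓞 K} {a b : Polynomial (𝓞 K)}
    (hab : a * f + b * Polynomial.derivative f = Polynomial.C N)
    (𝔭 : Ideal (𝓞 K)) [𝔭.IsPrime] (hN : N ∉ 𝔭) :
    (monogenicModel θ hintegral hgen).IsSmoothAt 𝔭 := by
  have hsep : (f.map (algebraMap (𝓞 K) (Localization.AtPrime 𝔭))).Separable := by
    obtain ⟨c, hc⟩ := (IsLocalization.map_units (Localization.AtPrime 𝔭)
      (⟨N, hN⟩ : 𝔭.primeCompl)).exists_left_inv
    have h1 := congrArg (Polynomial.map (algebraMap (𝓞 K) (Localization.AtPrime 𝔭))) hab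
    rw [Polynomial.map_add, Polynomial.map_mul, Polynomial.map_mul, Polynomial.map_C,
      ← Polynomial.derivative_map] at h1
    refine ⟨Polynomial.C c * a.map (algebraMap _ _), Polynomial.C c * b.map (algebraMap _ _), ?_⟩
    rw [mul_assoc, mul_assoc, ← mul_add, h1, ← Polynomial.C_mul, hc, Polynomial.C_1]
  have := etale_tensorProduct (exists_aeval_generator (hintegral := hintegral) (hgen := hgen))
    (aeval_generator_eq_zero hf) (dvd_of_aeval_generator_eq_zero hθ hmonic hf)
    (Localization.AtPrime 𝔭) hmonic hsep
  change Algebra.Smooth _ _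
  infer_instance

end Annihilator

/-! ### Geometric points of the special fibre -/

variable {𝔭 : Ideal (𝓞 K)}

theorem algebraMap_residue_eq_zero_iff (P : PlaceOver Kbar 𝔭) (x : 𝓞 K) :
    algebraMap (𝓞 K) P.Residue x = 0 ↔ x ∈ 𝔭 := by
  refine ⟨fun h => (P.mem_iff x).mp ?_, P.algebraMap_eq_zero x⟩
  rw [IsScalarTower.algebraMap_apply (𝓞 K) P.ring P.Residue, IsLocalRing.ResidueField.algebraMap_eq,
    IsLocalRing.residue_eq_zero_iff] at h
  exact ValuationSubring.mem_nonunits_iff_exists_mem_maximalIdeal.mpr ⟨_, h⟩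

/-- The residue of the value at `p` of an integral element `θ`. -/
noncomputable def residueAt (P : PlaceOver Kbar 𝔭) (hintegral : IsIntegral (𝓞 K) θ)
    (p : B →ₐ[K] Kbar) : P.Residue :=
  IsLocalRing.residue P.ring ⟨p θ, mem_of_isIntegral_ringOfIntegers P.ring
    (hintegral.map (p.restrictScalars (𝓞 K)))⟩

theorem reducePoint_generator (P : PlaceOver Kbar 𝔭) (p : B →ₐ[K] Kbar) :
    (monogenicModel θ hintegral hgen).reducePoint P p (1 ⊗ₜ generator θ hintegral hgen) =
      residueAt P hintegral p := by
  unfold IntegralModel.reducePoint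
  rw [Algebra.TensorProduct.lift_tmul, map_one, one_mul]
  rfl

theorem fibre_algHom_ext (P : PlaceOver Kbar 𝔭)
    {q q' : (monogenicModel θ hintegral hgen).Fibre 𝔭 →ₐ[𝓞 K ⧸ 𝔭] P.Residue}
    (h : q (1 ⊗ₜ generator θ hintegral hgen) = q' (1 ⊗ₜ generator θ hintegral hgen)) : q = q' :=
  Algebra.TensorProduct.ext (by ext) (algHom_ext_of_generator exists_aeval_generator h)

theorem residue_aeval (P : PlaceOver Kbar 𝔭) (p : B →ₐ[K] Kbar) (h : Polynomial (𝓞 K)) (z : P.ring)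
    (hz : (z : Kbar) = Polynomial.aeval (p θ) h) :
    IsLocalRing.residue P.ring z = Polynomial.aeval (residueAt P hintegral p) h := by
  have h1 : z = Polynomial.aeval (⟨p θ, mem_of_isIntegral_ringOfIntegers P.ring
      (hintegral.map (p.restrictScalars (𝓞 K)))⟩ : P.ring) h := by
    refine Subtype.ext (hz.trans ?_)
    rw [Polynomial.aeval_def, Polynomial.aeval_def]
    exact (Polynomial.hom_eval₂ h (algebraMap (𝓞 K) P.ring) P.ring.subtype ⟨p θ, _⟩).symm
  rw [h1]
  exact (Polynomial.aeval_algHom_apply (IsScalarTower.toAlgHom (𝓞 K) P.ring P.Residue) _ h).symm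

/-- A point of the fibre is determined by its value at the generator, a root of the reduction of
`f`. That reduction splits into the factors `X - residueAt P hintegral p`, so the value is the
residue of some `p θ`. -/
theorem exists_reducePoint_eq [IsAlgClosed Kbar] [Module.Finite K B] [IsReduced B]
    [Fintype (B →ₐ[K] Kbar)] {f : Polynomial (𝓞 K)}
    (hf : f.map (algebraMap (𝓞 K) Kbar) =
      ∏ p : B →ₐ[K] Kbar, (Polynomial.X - Polynomial.C (p θ))) (P : PlaceOver Kbar 𝔭)
    (q : (monogenicModel θ hintegral hgen).Fibre 𝔭 →ₐ[𝓞 K ⧸ 𝔭] P.Residue) :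
    ∃ p : B →ₐ[K] Kbar, (monogenicModel θ hintegral hgen).reducePoint P p = q := by
  let q₀ : (monogenicModel θ hintegral hgen).order →ₐ[𝓞 K] P.Residue :=
    (q.restrictScalars (𝓞 K)).comp Algebra.TensorProduct.includeRight
  have h0 : Polynomial.aeval (q₀ (generator θ hintegral hgen)) f = 0 := by
    rw [Polynomial.aeval_algHom_apply, aeval_generator_eq_zero hf, map_zero]
  have hA : f.map (algebraMap (𝓞 K) P.ring) = ∏ p : B →ₐ[K] Kbar,
      (Polynomial.X - Polynomial.C (⟨p θ, mem_of_isIntegral_ringOfIntegers P.ring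
        (hintegral.map (p.restrictScalars (𝓞 K)))⟩ : P.ring)) := by
    refine Polynomial.map_injective P.ring.subtype Subtype.val_injective ?_
    rw [Polynomial.map_map, Polynomial.map_prod]
    refine Eq.trans hf (Finset.prod_congr rfl fun p _ => ?_)
    rw [Polynomial.map_sub, Polynomial.map_X, Polynomial.map_C]
    rfl
  have hk : f.map (algebraMap (𝓞 K) P.Residue) = ∏ p : B →ₐ[K] Kbar,
      (Polynomial.X - Polynomial.C (residueAt P hintegral p)) := by
    rw [IsScalarTower.algebraMap_eq (𝓞 K) P.ring P.Residue, ← Polynomial.map_map, hA,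
      Polynomial.map_prod]
    refine Finset.prod_congr rfl fun p _ => ?_
    rw [Polynomial.map_sub, Polynomial.map_X, Polynomial.map_C]
    rfl
  rw [← Polynomial.eval_map_algebraMap, hk, Polynomial.eval_prod, Finset.prod_eq_zero_iff] at h0
  obtain ⟨p, -, hp⟩ := h0
  rw [Polynomial.eval_sub, Polynomial.eval_X, Polynomial.eval_C, sub_eq_zero] at hp
  refine ⟨p, fibre_algHom_ext P ?_⟩
  rw [reducePoint_generator, ← hp]
  rfl

/-- Differences of distinct values of `θ` are units at the place, so their residues are nonzero. -/
theorem reducePoint_injective (hθ : Function.Injective fun p : B →ₐ[K] Kbar => p θ)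
    (P : PlaceOver Kbar 𝔭) (hP : ∀ pq : (B →ₐ[K] Kbar) × (B →ₐ[K] Kbar),
      (pq.1 θ - pq.2 θ)⁻¹ ∈ P.ring) :
    Function.Injective ((monogenicModel θ hintegral hgen).reducePoint P) := by
  intro p q hpq
  by_contra hne
  have h1 := reducePoint_generator (hintegral := hintegral) (hgen := hgen) P p
  rw [hpq, reducePoint_generator] at h1
  have h2 := sub_eq_zero.mpr h1
  unfold residueAt at h2
  rw [← map_sub, IsLocalRing.residue_eq_zero_iff] at h2
  refine (IsLocalRing.mem_maximalIdeal _).mp h2 ?_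
  have hne' : q θ - p θ ≠ 0 := sub_ne_zero.mpr (hθ.ne (Ne.symm hne))
  exact IsUnit.of_mul_eq_one ⟨_, hP (q, p)⟩ (Subtype.ext (mul_inv_cancel₀ hne'))

end Model

/-! ### Good reduction of the quartic -/

/-- By the Nullstellensatz, smoothness puts a power of each coordinate in the ideal of `F` and its
partials. With denominators cleared this is an identity over `𝓞 K`, which certifies smoothness
modulo every prime not containing `E * D`. -/
theorem exists_quarticGoodReduction {K : Type u} [Field K] [NumberField K] {Kbar : Type v}
    [Field Kbar] [Algebra K Kbar] [IsAlgClosed Kbar] {F : MvPolynomial (Fin 4) K}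
    (hF : IsSmoothQuartic F Kbar) : ∃ N : 𝓞 K, N ≠ 0 ∧ ∀ (𝔭 : Ideal (𝓞 K)) [𝔭.IsPrime], N ∉ 𝔭 →
      ∀ P : PlaceOver Kbar 𝔭, QuarticGoodReduction F P := by
  classical
  let g : Option (Fin 4) → MvPolynomial (Fin 4) K := fun o => o.elim F fun i => MvPolynomial.pderiv i F
  let I : Ideal (MvPolynomial (Fin 4) K) := Ideal.span (Set.range g)
  have hX : ∀ i, MvPolynomial.X i ∈ I.radical := by
    intro i
    rw [← MvPolynomial.vanishingIdeal_zeroLocus_eq_radical (K := Kbar),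
      MvPolynomial.mem_vanishingIdeal_iff]
    intro x hx
    have hx' : ∀ o, MvPolynomial.aeval x (g o) = 0 := fun o =>
      hx _ (Ideal.subset_span ⟨o, rfl⟩)
    have hx0 : x = 0 := by
      by_contra hne
      obtain ⟨j, hj⟩ := hF.2 x hne (hx' none)
      exact hj (hx' (some j))
    simp [hx0]
  choose n hn using fun i => Ideal.mem_radical_iff.mp (hX i)
  have hcomb : ∀ i, ∃ c : Option (Fin 4) → MvPolynomial (Fin 4) K,
      ∑ o, c o * g o = MvPolynomial.X i ^ n i := fun i =>
    (Ideal.mem_span_range_iff_exists_fun).mp (hn i)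
  choose c hc using hcomb
  obtain ⟨D, hD, hG⟩ := exists_mvPolynomial_map_eq_C_mul fun _ : Unit => F
  obtain ⟨G, hG⟩ := hG ()
  obtain ⟨E, hE, hH⟩ := exists_mvPolynomial_map_eq_C_mul fun io : Fin 4 × Option (Fin 4) => c io.1 io.2
  choose H hH using hH
  have hinj : Function.Injective (MvPolynomial.map (σ := Fin 4) (algebraMap (𝓞 K) K)) :=
    MvPolynomial.map_injective _ NumberField.RingOfIntegers.coe_injective
  let g' : Option (Fin 4) → MvPolynomial (Fin 4) (𝓞 K) := fun o =>
    o.elim G fun i => MvPolynomial.pderiv i G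
  have hg' : ∀ o, MvPolynomial.map (algebraMap (𝓞 K) K) (g' o) =
      MvPolynomial.C (algebraMap (𝓞 K) K D) * g o := by
    rintro (_ | i)
    · exact hG
    · change MvPolynomial.map _ (MvPolynomial.pderiv i G) = _
      rw [← MvPolynomial.pderiv_map, hG, MvPolynomial.pderiv_C_mul]
      rfl
  have hid : ∀ i, ∑ o, H (i, o) * g' o = MvPolynomial.C (E * D) * MvPolynomial.X i ^ n i := by
    intro i
    refine hinj ?_
    rw [map_sum, map_mul, map_pow, MvPolynomial.map_X, MvPolynomial.map_C, ← hc i, Finset.mul_sum]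
    refine Finset.sum_congr rfl fun o _ => ?_
    rw [map_mul, hH, hg', map_mul, MvPolynomial.C_mul]
    ring
  refine ⟨E * D, mul_ne_zero hE hD, fun 𝔭 _ hN P => ⟨G, algebraMap (𝓞 K) K D, ?_, hG, ?_, ?_⟩⟩
  · exact fun h0 => hD (NumberField.RingOfIntegers.coe_injective (h0.trans (map_zero _).symm))
  · refine MvPolynomial.IsHomogeneous.map ?_ _
    have h1 : (MvPolynomial.map (algebraMap (𝓞 K) K) G).IsHomogeneous 4 := by
      rw [hG]; exact hF.1.C_mul _
    exact MvPolynomial.IsHomogeneous.of_map NumberField.RingOfIntegers.coe_injective h1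
  · intro x hx hxG
    by_contra! hcon
    refine hx (funext fun i => ?_)
    have hmap : ∀ f : MvPolynomial (Fin 4) (𝓞 K), MvPolynomial.aeval x
        (MvPolynomial.map (Ideal.Quotient.mk 𝔭) f) = MvPolynomial.aeval x f := fun f =>
      MvPolynomial.aeval_map_algebraMap (𝓞 K ⧸ 𝔭) x f
    have h0 : ∀ o, MvPolynomial.aeval x (g' o) = 0 := by
      rintro (_ | j)
      · rw [← hmap]; exact hxG
      · have := hcon j
        rw [MvPolynomial.pderiv_map, hmap] at this
        exact this
    have h1 := congrArg (MvPolynomial.aeval x) (hid i)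
    rw [map_sum, Finset.sum_eq_zero fun o _ => by rw [map_mul, h0, mul_zero], map_mul, map_pow,
      MvPolynomial.aeval_X, MvPolynomial.aeval_C] at h1
    have h2 : algebraMap (𝓞 K) P.Residue (E * D) ≠ 0 := by
      exact fun h => hN ((algebraMap_residue_eq_zero_iff P _).mp h)
    exact eq_zero_of_pow_eq_zero ((mul_eq_zero.mp h1.symm).resolve_left h2)

/-! ### Good reduction of schemes of lines -/

theorem mem_span_conj_iff {k Ω : Type*} [CommRing k] [Field Ω] [Algebra k Ω] {n : ℕ}
    (τ : Ω ≃ₐ[k] Ω) (b : Fin n → Fin 4 → Ω) (x : Fin 4 → Ω) :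
    (fun i => τ (x i)) ∈ Submodule.span Ω (Set.range fun r i => τ (b r i)) ↔
      x ∈ Submodule.span Ω (Set.range b) := by
  have key : ∀ (τ : Ω ≃ₐ[k] Ω) (b : Fin n → Fin 4 → Ω) (x : Fin 4 → Ω),
      x ∈ Submodule.span Ω (Set.range b) →
        (fun i => τ (x i)) ∈ Submodule.span Ω (Set.range fun r i => τ (b r i)) := by
    intro τ b x hx
    obtain ⟨c, rfl⟩ := (Submodule.mem_span_range_iff_exists_fun Ω).mp hx
    refine (Submodule.mem_span_range_iff_exists_fun Ω).mpr ⟨fun r => τ (c r), ?_⟩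
    funext i
    simp [Finset.sum_apply]
  refine ⟨fun h => ?_, key τ b x⟩
  simpa using key τ.symm _ _ h

section SchemeOfLines

variable {K : Type u} [Field K] {Kbar : Type v} [Field Kbar] [Algebra K Kbar]
  {F : MvPolynomial (Fin 4) K}

theorem SchemeOfLines.η_comp (S : SchemeOfLines F Kbar) (σ : Kbar ≃ₐ[K] Kbar)
    (p : S.B →ₐ[K] Kbar) : S.η ((σ : Kbar →ₐ[K] Kbar).comp p) = galConj σ (S.η p) := by
  ext x
  have h1 := S.equivariant σ p (fun i => σ.symm (x i))
  simp only [AlgEquiv.apply_symm_apply] at h1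
  exact h1

theorem SchemeOfLines.finrank_η (S : SchemeOfLines F Kbar) (p : S.B →ₐ[K] Kbar) :
    Module.finrank Kbar (S.η p) = 2 :=
  (S.bijOn.mapsTo (Set.mem_univ p)).1

/-- The lines are spanned by vectors whose coordinates are polynomials with integral coefficients
in the value of a separating element. -/
theorem SchemeOfLines.exists_spanning_polynomials [NumberField K] [IsGalois K Kbar]
    (S : SchemeOfLines F Kbar)
    {θ : S.B} (hθ : Function.Injective fun p : S.B →ₐ[K] Kbar => p θ) :
    ∃ G : Fin 2 → Fin 4 → Polynomial (𝓞 K), ∀ p : S.B →ₐ[K] Kbar,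
      LinearIndependent Kbar (fun r m => Polynomial.aeval (p θ) (G r m)) ∧
      Submodule.span Kbar (Set.range fun r m => Polynomial.aeval (p θ) (G r m)) = S.η p := by
  choose g hg using fun rm : Fin 2 × Fin 4 => exists_interpolating_polynomial hθ
    (fun p => frame (S.η p) rm.1 rm.2) fun σ p => by
      rw [S.η_comp, frame_galConj σ (S.finrank_η p)]
  obtain ⟨N, hN, hG⟩ := exists_map_eq_C_mul g
  choose G hG using hG
  have hN' : algebraMap (𝓞 K) Kbar N ≠ 0 := fun h0 =>
    hN (algebraMap_ringOfIntegers_injective (by rw [h0, map_zero]))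
  refine ⟨fun r m => G (r, m), fun p => ?_⟩
  have hval : (fun r m => Polynomial.aeval (p θ) (G (r, m))) =
      fun r => Units.mk0 _ hN' • frame (S.η p) r := by
    funext r m
    rw [← Polynomial.aeval_map_algebraMap K, hG, map_mul, Polynomial.aeval_C, hg]
    rfl
  rw [hval]
  refine ⟨(linearIndependent_frame (S.finrank_η p)).units_smul fun _ => Units.mk0 _ hN', ?_⟩
  conv_rhs => rw [← span_frame (S.finrank_η p)]
  refine le_antisymm (Submodule.span_le.mpr ?_) (Submodule.span_le.mpr ?_)
  · rintro _ ⟨r, rfl⟩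
    exact Submodule.smul_mem _ _ (Submodule.subset_span ⟨r, rfl⟩)
  · rintro _ ⟨r, rfl⟩
    have h1 : Units.mk0 _ hN' • frame (S.η p) r ∈
        Submodule.span Kbar (Set.range fun r => Units.mk0 _ hN' • frame (S.η p) r) :=
      Submodule.subset_span ⟨r, rfl⟩
    have h2 := Submodule.smul_mem _ (algebraMap (𝓞 K) Kbar N)⁻¹ h1
    rwa [Units.smul_mk0, inv_smul_smul₀ hN'] at h2

/-- Separability descends to `K`; clearing denominators in its Bézout identity produces `N`, which
plays the role of a discriminant. -/
theorem exists_bezout [NumberField K] {f : Polynomial (𝓞 K)}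
    (hf : (f.map (algebraMap (𝓞 K) Kbar)).Separable) : ∃ (N : 𝓞 K) (a b : Polynomial (𝓞 K)),
      N ≠ 0 ∧ a * f + b * Polynomial.derivative f = Polynomial.C N := by
  have hfK : (f.map (algebraMap (𝓞 K) K)).Separable := by
    rw [← Polynomial.separable_map (algebraMap K Kbar), Polynomial.map_map,
      ← IsScalarTower.algebraMap_eq]
    exact hf
  obtain ⟨a, b, hab⟩ := hfK
  obtain ⟨N, hN, hG⟩ := exists_map_eq_C_mul ![a, b]
  obtain ⟨a', ha'⟩ := hG 0
  obtain ⟨b', hb'⟩ := hG 1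
  refine ⟨N, a', b', hN, ?_⟩
  refine Polynomial.map_injective (algebraMap (𝓞 K) K)
    NumberField.RingOfIntegers.coe_injective ?_
  rw [Polynomial.map_add, Polynomial.map_mul, Polynomial.map_mul, ha', hb',
    ← Polynomial.derivative_map, Polynomial.map_C]
  simp only [Matrix.cons_val_zero, Matrix.cons_val_one]
  linear_combination Polynomial.C (algebraMap (𝓞 K) K N) * hab

theorem SchemeOfLines.exists_hasGoodReductionAt [NumberField K] [IsAlgClosure K Kbar]
    (hF : IsSmoothQuartic F Kbar) (S : SchemeOfLines F Kbar) :
    ∃ D : ℕ, 0 < D ∧ ∀ p : ℕ, p.Prime → ¬ p ∣ D →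
      ∀ (𝔭 : Ideal (𝓞 K)) [𝔭.IsMaximal], (p : 𝓞 K) ∈ 𝔭 → S.HasGoodReductionAt 𝔭 := by
  classical
  have hac : IsAlgClosed Kbar := IsAlgClosure.isAlgClosed K
  have halg : Algebra.IsAlgebraic K Kbar := IsAlgClosure.isAlgebraic
  have hgal : IsGalois K Kbar := IsAlgClosure.isGalois K Kbar
  have hchar : CharZero Kbar := charZero_of_injective_algebraMap (algebraMap K Kbar).injective
  have hintegral : Algebra.IsAlgebraic ℤ Kbar := isAlgebraic_int (K := K)
  have := Fintype.ofFinite (S.B →ₐ[K] Kbar)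
  obtain ⟨θ, hθint, hθ⟩ := exists_integral_separating_element (K := K) (Kbar := Kbar) (B := S.B)
  have hgen : ∀ b : S.B, ∃ g : Polynomial K, Polynomial.aeval θ g = b := by
    intro b
    obtain ⟨g, hg⟩ := exists_interpolating_polynomial hθ (fun p => p b) fun σ p => rfl
    refine ⟨g, sub_eq_zero.mp (eq_zero_of_forall_algHom (K := K) (Kbar := Kbar) fun p => ?_)⟩
    rw [map_sub, ← Polynomial.aeval_algHom_apply, hg, sub_self]
  obtain ⟨f, hmonic, hf⟩ := exists_integral_annihilator (Kbar := Kbar) hθint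
  obtain ⟨N, a, b, hN, hab⟩ := exists_bezout (Kbar := Kbar) (f := f)
    (hf ▸ Polynomial.separable_prod_X_sub_C_iff.mpr hθ)
  obtain ⟨N', hN', hquartic⟩ := exists_quarticGoodReduction hF
  obtain ⟨G, hG⟩ := S.exists_spanning_polynomials hθ
  have hfin : (Set.range S.η).Finite := Set.finite_range _
  -- In order, the conditions serve smoothness of the model, smoothness of the quartic, injectivity
  -- on geometric points, reduction of the spanning vectors, and the incidence graph.
  obtain ⟨D, hD, h⟩ := exists_forall_place_of_eventually (K := K)
    ((eventually_mem (algebraMap (𝓞 K) Kbar N)⁻¹).and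
    ((eventually_mem (algebraMap (𝓞 K) Kbar N')⁻¹).and
    ((eventually_forall_mem fun pq : (S.B →ₐ[K] Kbar) × (S.B →ₐ[K] Kbar) =>
      (pq.1 θ - pq.2 θ)⁻¹).and
    ((Filter.eventually_all.mpr fun p => eventually_reduceAt_span (hG p).1).and
    (eventually_exists_incidenceGraph_iso hfin)))))
  refine ⟨D, hD, fun p hp hpD 𝔭 _ hp𝔭 => ?_⟩
  have hplace := h p hp hpD 𝔭 hp𝔭
  -- Smoothness of the model concerns `𝔭` alone, while the conditions were imposed on places; one
  -- place above `𝔭` suffices to transfer them.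
  obtain ⟨P₀⟩ := PlaceOver.nonempty (Kbar := Kbar) 𝔭
  have hN𝔭 : N ∉ 𝔭 := notMem_of_inv_mem P₀ hN (hplace P₀).1
  have hN𝔭' : N' ∉ 𝔭 := notMem_of_inv_mem P₀ hN' (hplace P₀).2.1
  let M := monogenicModel θ hθint hgen
  refine ⟨M, isSmoothAt_monogenicModel hθ hmonic hf hab 𝔭 hN𝔭, fun P =>
    ⟨hquartic 𝔭 hN𝔭' P, ?_⟩⟩
  obtain ⟨-, -, hsub, hspan, hinj, hiso⟩ := hplace P
  let e : (S.B →ₐ[K] Kbar) ≃ (M.Fibre 𝔭 →ₐ[𝓞 K ⧸ 𝔭] P.Residue) :=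
    Equiv.ofBijective (M.reducePoint P)
      ⟨reducePoint_injective hθ P hsub, exists_reducePoint_eq hf P⟩
  let η' : (M.Fibre 𝔭 →ₐ[𝓞 K ⧸ 𝔭] P.Residue) → Submodule P.Residue (Fin 4 → P.Residue) := fun q =>
    P.reduce (S.η (e.symm q))
  -- This description no longer mentions the lift of `q`. Since the polynomials `G` have
  -- coefficients in `𝓞 K`, an automorphism over `𝓞 K ⧸ 𝔭` passes through them, which gives
  -- equivariance.
  have hη' : ∀ q, η' q = Submodule.span P.Residue (Set.range fun r m =>
      Polynomial.aeval (q (1 ⊗ₜ generator θ hθint hgen)) (G r m)) := by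
    intro q
    have h1 : q (1 ⊗ₜ generator θ hθint hgen) = residueAt P hθint (e.symm q) := by
      rw [← reducePoint_generator (hgen := hgen)]
      exact congrArg (fun q => q (1 ⊗ₜ generator θ hθint hgen)) (e.apply_symm_apply q).symm
    have hmem : ∀ r m, Polynomial.aeval (e.symm q θ) (G r m) ∈ P.ring := fun r m =>
      mem_of_isIntegral_ringOfIntegers P.ring (by
        have h2 := M.isIntegral_apply (e.symm q)
          (Polynomial.aeval (generator θ hθint hgen) (G r m))
        rwa [coe_aeval_generator, apply_aeval, Polynomial.eval_map_algebraMap] at h2)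
    have h2 := (hspan (e.symm q) (fun r m => ⟨_, hmem r m⟩) fun _ _ => rfl).2
    rw [(hG (e.symm q)).2] at h2
    refine Eq.trans h2 ?_
    rw [h1]
    congr 2
    funext r m
    exact residue_aeval P (e.symm q) (G r m) _ rfl
  have hrange : Set.range η' = reduceAt P.ring '' Set.range S.η := by
    rw [← Set.range_comp]
    exact e.symm.surjective.range_comp fun p => P.reduce (S.η p)
  refine ⟨η', fun q => ⟨_, S.bijOn.mapsTo (Set.mem_univ _), rfl⟩, fun q q' hqq => ?_, ?_,
    fun p => ?_, hiso _ hrange⟩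
  · exact e.symm.injective (S.bijOn.injOn (Set.mem_univ _) (Set.mem_univ _)
      (hinj ⟨_, rfl⟩ ⟨_, rfl⟩ hqq))
  · intro τ q x
    rw [hη', hη']
    have : ∀ r m, Polynomial.aeval (((τ : P.Residue →ₐ[𝓞 K ⧸ 𝔭] P.Residue).comp q)
        (1 ⊗ₜ generator θ hθint hgen)) (G r m) =
        τ (Polynomial.aeval (q (1 ⊗ₜ generator θ hθint hgen)) (G r m)) := fun r m =>
      Polynomial.aeval_algHom_apply
        ((τ : P.Residue →ₐ[𝓞 K ⧸ 𝔭] P.Residue).restrictScalars (𝓞 K)) _ _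
    simp only [this]
    exact mem_span_conj_iff τ _ x
  · exact congrArg (fun p => P.reduce (S.η p)) (e.symm_apply_apply p).symm

end SchemeOfLines

end LinesOnQuartic

theorem mainTheorem7 {K : Type*} [Field K] [NumberField K]
    {Kbar : Type*} [Field Kbar] [Algebra K Kbar] [IsAlgClosure K Kbar]
    (F : MvPolynomial (Fin 4) K) (hF : LinesOnQuartic.IsSmoothQuartic F Kbar) :
    Nonempty (LinesOnQuartic.SchemeOfLines F Kbar) ∧
    ∀ S : LinesOnQuartic.SchemeOfLines F Kbar,
      ∃ D : ℕ, 0 < D ∧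
        ∀ p : ℕ, p.Prime → ¬ p ∣ D →
          ∀ (𝔭 : Ideal (𝓞 K)) [𝔭.IsMaximal], (p : 𝓞 K) ∈ 𝔭 →
            S.HasGoodReductionAt 𝔭 :=
  ⟨LinesOnQuartic.exists_schemeOfLines hF, fun S => S.exists_hasGoodReductionAt hF⟩
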